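/- \textbf{Chromatic homology.} Let $G$ be a finite graph (parallel edges allowed) whose edge set is linearly ordered. An enhanced state of $G$ is a pair $S=(s,c)$, where $s\subseteq E(G)$ and $c$ assigns a colour $1$ or $x$ to each connected component of the spanning graph $[G:s]=(V(G),s)$; put $i(S)=\#s$ and let $j(S)$ be the number of components coloured $x$. For $i,j\in\mathbb Z$ let $C^{i,j}(G)$ be the free $\mathbb Z$-module on the enhanced states with $i(S)=i$, $j(S)=j$, and let $\partial\colon C^{i,j}(G)\to C^{i+1,j}(G)$ be given by $\partial S=\sum_{f\in E(G)\setminus s}(-1)^{n(f)}S_f$, where $n(f)$ is the number of edges of $s$ preceding $f$ and $S_f=(s\cup\{f\},c_f)$: if $f$ joins two different components of $[G:s]$, the new component gets the product of their colours in $\mathbb Z[x]/(x^2)$ (and $S_f=0$ if both are $x$); all other colours are unchanged. Let $H^{i,j}(G)$ be the cohomology of $(C^{*,j}(G),\partial)$ at $C^{i,j}(G)$, and let $H^i(G)=\ker\partial^i/\operatorname{im}\partial^{i-1}$ be the cohomology of the total complex $C^i(G)=\bigoplus_j C^{i,j}(G)$, so that $H^i(G)=\bigoplus_j H^{i,j}(G)$.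 For an edge $e$ of $G$ with two distinct ends, let $G-e$ be the deletion and $G/e$ the contraction, a graph with edge set $E(G)\setminus\{e\}$ (parallel edges are kept), both with the order inherited from $G$. Let $\alpha\colon C^{i,j}(G/e)\to C^{i+1,j}(G)$ be the chain map $(s,c)\mapsto(-1)^{\#\{f\in s\,:\,f>e\}}(s\cup\{e\},\tilde c)$, where each component of $[G:s\cup\{e\}]$ has the colour of its image in $G/e$, and let $\beta\colon C^{i,j}(G)\to C^{i,j}(G-e)$ be the chain map with $\beta(s,c)=(s,c)$ if $e\notin s$ and $\beta(s,c)=0$ if $e\in s$. \textbf{Theorem.} Let $n\ge 4$ and $2\le m\le n-1$. Let $G=K_{n-1}^m$ be the graph on the vertices $1,\dots,n$ that consists of the complete graph on $1,\dots,n-1$ and the edges $\{t,n\}$, $1\le t\le m$; its edges $\{a,b\}$, $a<b$, are ordered lexicographically by $(a,b)$. Let $e=\{m,n\}$. Then for all $i,j\in\mathbb Z$ with $i+j\in\{n-2,n-1,n\}$ the sequence $$0\to H^{i,j}(G/e)\xrightarrow{\alpha^*}H^{i+1,j}(G)\xrightarrow{\beta^*}H^{i+1,j}(G-e)\to 0$$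 is split exact, and, summing over $j$, for all $i\in\mathbb Z$ the sequence $$0\to H^{i}(G/e)\xrightarrow{\alpha^*}H^{i+1}(G)\xrightarrow{\beta^*}H^{i+1}(G-e)\to 0$$ is split exact. -/

import Mathlib

open scoped Graph

namespace ChromaticHomology

noncomputable section

/-! ### Enhanced states

Graphs are Mathlib's multigraphs `Graph α β` (vertices in `α`, edges in `β`, loops and parallel
edges allowed). The linear order on `β` is the order of the edges. -/

section States

variable {α β : Type*}

/-- The two colours `1` and `x`, which form a basis of `ℤ[x]/(x²)`. -/
inductive Colour
  | one
  | x

/-- The connected components of the spanning graph `[G : s]`. -/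
def Component (G : Graph α β) (s : Finset β) : Type _ :=
  Quot (fun u v : V(G) => (G.restrict (s : Set β)).Adj u v)

/-- The component of `[G : s]` containing the vertex `v`. -/
def component (G : Graph α β) (s : Finset β) (v : V(G)) : Component G s :=
  Quot.mk _ v

/-- An enhanced state `(s, c)` of `G`: a set `s` of edges and a colouring of the connected
components of `[G : s]`. The colouring is recorded as a function on vertices which takes the same
value at the two ends of every edge of `s`; see `componentColour`. -/
@[ext]
structure EnhancedState (G : Graph α β) where
  edges : Finset β
  edges_subset : (edges : Set β) ⊆ E(G)
  colour : V(G) → Colour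
  colour_eq : ∀ u v : V(G), (G.restrict (edges : Set β)).Adj u v → colour u = colour v

namespace EnhancedState

variable {G : Graph α β}

/-- The colour of a connected component of `[G : s]`. -/
def componentColour (S : EnhancedState G) : Component G S.edges → Colour :=
  Quot.lift S.colour S.colour_eq

/-- `j(S)`, the number of components coloured `x`. -/
def xCount (S : EnhancedState G) : ℕ :=
  Nat.card {K : Component G S.edges // S.componentColour K = Colour.x}

variable [DecidableEq β]

/-- Adding the edge `f` would multiply `x` by `x`: some component of `[G : s ∪ {f}]` contains two
distinct components of `[G : s]` which are both coloured `x`. (A component of `[G : s ∪ {f}]` is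
either a component of `[G : s]`, possibly with the edge `f` added to it, or the union of two
components of `[G : s]` which are joined by `f`.) -/
def Vanishes (S : EnhancedState G) (f : β) : Prop :=
  ∃ u v : V(G), S.colour u = Colour.x ∧ S.colour v = Colour.x ∧
    component G (insert f S.edges) u = component G (insert f S.edges) v ∧
    component G S.edges u ≠ component G S.edges v

open Classical in
/-- The enhanced state `S_f = (s ∪ {f}, c_f)`, for `f` such that no product `x · x` occurs: a
component of `[G : s ∪ {f}]` is coloured `x` if it contains a component of `[G : s]` coloured
`x`, and `1` otherwise. -/
def addEdge (S : EnhancedState G) (f : E(G)) : EnhancedState G where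
  edges := insert (f : β) S.edges
  edges_subset := by
    intro g hg
    rcases Finset.mem_insert.1 (Finset.mem_coe.1 hg) with rfl | h
    · exact f.2
    · exact S.edges_subset h
  colour v :=
    if ∃ u : V(G), component G (insert (f : β) S.edges) u = component G (insert (f : β) S.edges) v ∧
      S.colour u = Colour.x then Colour.x else Colour.one
  colour_eq u v h := by
    have : component G (insert (f : β) S.edges) u = component G (insert (f : β) S.edges) v :=
      Quot.sound h
    rw [this]

lemma colour_eq_of_component_eq (S : EnhancedState G) {u v : V(G)}
    (h : component G S.edges u = component G S.edges v) : S.colour u = S.colour v :=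
  congrArg S.componentColour h

lemma addEdge_colour_eq_x (S : EnhancedState G) (f : E(G)) (v : V(G)) :
    (S.addEdge f).colour v = Colour.x ↔ ∃ u : V(G),
      component G (insert (f : β) S.edges) u = component G (insert (f : β) S.edges) v ∧
        S.colour u = Colour.x := by
  unfold addEdge
  simp only
  split_ifs with h
  · exact ⟨fun _ => h, fun _ => rfl⟩
  · exact ⟨fun h' => h'.elim, fun h' => absurd h' h⟩

/-- Passing to a larger set of edges maps components to components. -/
lemma component_eq_of_subset {s t : Finset β} (hst : s ⊆ t) {u v : V(G)}
    (h : component G s u = component G s v) : component G t u = component G t v := by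
  let φ : Component G s → Component G t :=
    Quot.lift (component G t) (by
      rintro u v ⟨f, hf, h⟩
      exact Quot.sound ⟨f, Finset.mem_coe.2 (hst (Finset.mem_coe.1 hf)), h⟩)
  exact congrArg φ h

lemma xCount_addEdge (S : EnhancedState G) (f : E(G)) (hf : ¬ S.Vanishes f) :
    (S.addEdge f).xCount = S.xCount := by
  let φ : Component G S.edges → Component G (insert (f : β) S.edges) :=
    Quot.lift (component G _) fun u v h =>
      component_eq_of_subset (Finset.subset_insert _ _) (Quot.sound h)
  have hφ : ∀ K, S.componentColour K = Colour.x →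
      (S.addEdge f).componentColour (φ K) = Colour.x := by
    rintro ⟨u⟩ hu
    exact (addEdge_colour_eq_x S f u).2 ⟨u, rfl, hu⟩
  symm
  refine Nat.card_congr (Equiv.ofBijective
    (fun K => (⟨φ K.1, hφ K.1 K.2⟩ :
      {K : Component G (S.addEdge f).edges // (S.addEdge f).componentColour K = Colour.x})) ⟨?_, ?_⟩)
  · rintro ⟨⟨u⟩, hu⟩ ⟨⟨v⟩, hv⟩ h
    have h' : component G (insert (f : β) S.edges) u = component G (insert (f : β) S.edges) v :=
      congrArg Subtype.val h
    apply Subtype.ext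
    by_contra hne
    exact hf ⟨u, v, hu, hv, h', hne⟩
  · rintro ⟨⟨v⟩, hv⟩
    obtain ⟨u, huv, hu⟩ := (addEdge_colour_eq_x S f v).1 hv
    exact ⟨⟨component G _ u, hu⟩, Subtype.ext huv⟩

lemma vanishes_addEdge_iff (S : EnhancedState G) (f g : E(G)) :
    S.Vanishes f ∨ (S.addEdge f).Vanishes g ↔
      ∃ u v : V(G), S.colour u = Colour.x ∧ S.colour v = Colour.x ∧
        component G (insert (g : β) (insert (f : β) S.edges)) u =
          component G (insert (g : β) (insert (f : β) S.edges)) v ∧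
        component G S.edges u ≠ component G S.edges v := by
  have hsub : insert (f : β) S.edges ⊆ insert (g : β) (insert (f : β) S.edges) :=
    Finset.subset_insert _ _
  constructor
  · rintro (⟨u, v, hu, hv, h1, h2⟩ | ⟨u, v, hu, hv, h1, h2⟩)
    · exact ⟨u, v, hu, hv, component_eq_of_subset hsub h1, h2⟩
    · obtain ⟨u', hu', hu''⟩ := (addEdge_colour_eq_x S f u).1 hu
      obtain ⟨v', hv', hv''⟩ := (addEdge_colour_eq_x S f v).1 hv
      refine ⟨u', v', hu'', hv'', ?_, fun h => h2 ?_⟩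
      · exact (component_eq_of_subset hsub hu').trans
          (h1.trans (component_eq_of_subset hsub hv').symm)
      · exact hu'.symm.trans
          ((component_eq_of_subset (Finset.subset_insert _ _) h).trans hv')
  · rintro ⟨u, v, hu, hv, h1, h2⟩
    by_cases h : component G (insert (f : β) S.edges) u = component G (insert (f : β) S.edges) v
    · exact Or.inl ⟨u, v, hu, hv, h, h2⟩
    · exact Or.inr ⟨u, v, (addEdge_colour_eq_x S f u).2 ⟨u, rfl, hu⟩,
        (addEdge_colour_eq_x S f v).2 ⟨v, rfl, hv⟩, h1, h⟩

lemma addEdge_comm (S : EnhancedState G) (f g : E(G)) :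
    (S.addEdge f).addEdge g = (S.addEdge g).addEdge f := by
  have key : ∀ (f g : E(G)) (v : V(G)), ((S.addEdge f).addEdge g).colour v = Colour.x ↔
      ∃ u : V(G), component G (insert (g : β) (insert (f : β) S.edges)) u =
        component G (insert (g : β) (insert (f : β) S.edges)) v ∧ S.colour u = Colour.x := by
    intro f g v
    rw [addEdge_colour_eq_x]
    constructor
    · rintro ⟨u, h1, hu⟩
      obtain ⟨w, hw, hw'⟩ := (addEdge_colour_eq_x S f u).1 hu
      exact ⟨w, (component_eq_of_subset (Finset.subset_insert _ _) hw).trans h1, hw'⟩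
    · rintro ⟨u, h1, hu⟩
      exact ⟨u, h1, (addEdge_colour_eq_x S f u).2 ⟨u, rfl, hu⟩⟩
  apply EnhancedState.ext
  · exact Finset.insert_comm _ _ _
  · funext v
    have h := (key f g v).trans ((by rw [Finset.insert_comm]) : _ ↔ _) |>.trans (key g f v).symm
    rcases h1 : ((S.addEdge f).addEdge g).colour v with _ | _ <;>
      rcases h2 : ((S.addEdge g).addEdge f).colour v with _ | _ <;> simp_all

end EnhancedState

end States

/-! ### The chromatic complex and its homology -/

section Complex

variable {α β : Type*} [LinearOrder β]

/-- The free `ℤ`-module on all enhanced states of `G`. -/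
abbrev Cochain (G : Graph α β) : Type _ := EnhancedState G →₀ ℤ

/-- `C^{i,j}(G)`: spanned by the enhanced states with `i` edges and `j` components coloured `x`. -/
def bigradedPart (G : Graph α β) (i j : ℤ) : Submodule ℤ (Cochain G) :=
  Finsupp.supported ℤ ℤ {S | (S.edges.card : ℤ) = i ∧ (S.xCount : ℤ) = j}

/-- `C^i(G)`, the sum of the `C^{i,j}(G)` over all `j`: spanned by the enhanced states with `i`
edges. -/
def gradedPart (G : Graph α β) (i : ℤ) : Submodule ℤ (Cochain G) :=
  Finsupp.supported ℤ ℤ {S | (S.edges.card : ℤ) = i}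

open Classical in
/-- `S_f` as a cochain; it is `0` if a product `x · x = 0` occurs. -/
def addEdgeCochain {G : Graph α β} (S : EnhancedState G) (f : E(G)) : Cochain G :=
  if S.Vanishes f then 0 else Finsupp.single (S.addEdge f) 1

lemma supported_le_comap {G H : Graph α β} (φ : Cochain G →ₗ[ℤ] Cochain H)
    (p : Set (EnhancedState G)) (q : Set (EnhancedState H))
    (h : ∀ S ∈ p, φ (Finsupp.single S 1) ∈ Finsupp.supported ℤ ℤ q) :
    Finsupp.supported ℤ ℤ p ≤ (Finsupp.supported ℤ ℤ q).comap φ := by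
  rw [Finsupp.supported_eq_span_single, Submodule.span_le]
  rintro _ ⟨S, hS, rfl⟩
  exact h S hS

variable [Fintype β]

open Classical in
/-- The differential of a state: the sum over the edges `f` of `G` outside `s` of
`(-1)^{n(f)} S_f`, where `n(f)` is the number of edges of `s` that precede `f`. -/
def stateDifferential {G : Graph α β} (S : EnhancedState G) : Cochain G :=
  ∑ f : β, if h : f ∈ E(G) ∧ f ∉ S.edges then
    (-1 : ℤ) ^ (S.edges.filter (· < f)).card • addEdgeCochain S ⟨f, h.1⟩ else 0

/-- The differential; it maps `C^{i,j}(G)` into `C^{i+1,j}(G)`. -/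
def differential (G : Graph α β) : Cochain G →ₗ[ℤ] Cochain G :=
  Finsupp.linearCombination ℤ stateDifferential

lemma differential_single {G : Graph α β} (S : EnhancedState G) :
    differential G (Finsupp.single S 1) = stateDifferential S := by
  simp [differential]

/-- The differential has bidegree `(1, 0)`. -/
lemma differential_bigradedPart (G : Graph α β) (i j : ℤ) :
    bigradedPart G i j ≤ (bigradedPart G (i + 1) j).comap (differential G) := by
  apply supported_le_comap
  rintro S ⟨h1, h2⟩
  rw [differential_single]
  refine Submodule.sum_mem _ fun f _ => ?_
  split_ifs with h
  · refine Submodule.smul_mem _ _ ?_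
    unfold addEdgeCochain
    split_ifs with hv
    · exact Submodule.zero_mem _
    · refine Finsupp.single_mem_supported _ _ ⟨?_, ?_⟩
      · change ((insert f S.edges).card : ℤ) = i + 1
        rw [Finset.card_insert_of_notMem h.2]
        push_cast
        omega
      · rw [S.xCount_addEdge ⟨f, h.1⟩ hv]
        exact h2
  · exact Submodule.zero_mem _

open Classical in
/-- The differential squares to zero. -/
lemma differential_comp_differential (G : Graph α β) :
    differential G ∘ₗ differential G = 0 := by
  refine Finsupp.lhom_ext' fun S => LinearMap.ext_ring ?_
  simp only [LinearMap.comp_apply, Finsupp.lsingle_apply, LinearMap.zero_apply]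
  rw [differential_single]
  let T : β → β → Cochain G := fun f g =>
    if h : (f ∈ E(G) ∧ f ∉ S.edges) ∧ (g ∈ E(G) ∧ g ∉ insert f S.edges) then
      ((-1 : ℤ) ^ (S.edges.filter (· < f)).card *
        (-1 : ℤ) ^ ((insert f S.edges).filter (· < g)).card) •
      (if S.Vanishes f ∨ (S.addEdge ⟨f, h.1.1⟩).Vanishes g then 0 else
        Finsupp.single ((S.addEdge ⟨f, h.1.1⟩).addEdge ⟨g, h.2.1⟩) 1) else 0
  have hT : differential G (stateDifferential S) = ∑ f, ∑ g, T f g := by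
    rw [stateDifferential, map_sum]
    refine Finset.sum_congr rfl fun f _ => ?_
    by_cases hf : f ∈ E(G) ∧ f ∉ S.edges
    · rw [dif_pos hf, map_smul]
      unfold addEdgeCochain
      by_cases hv : S.Vanishes f
      · rw [if_pos hv, map_zero, smul_zero]
        symm
        refine Finset.sum_eq_zero fun g _ => ?_
        simp only [T, hv, true_or, if_true, smul_zero, dite_eq_ite, ite_self]
      · rw [if_neg hv, differential_single, stateDifferential, Finset.smul_sum]
        refine Finset.sum_congr rfl fun g _ => ?_
        by_cases hg : g ∈ E(G) ∧ g ∉ insert f S.edges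
        · rw [dif_pos (show g ∈ E(G) ∧ g ∉ (S.addEdge ⟨f, hf.1⟩).edges from hg), smul_smul]
          simp only [T, dif_pos (And.intro hf hg), hv, false_or]
          rfl
        · rw [dif_neg (show ¬ (g ∈ E(G) ∧ g ∉ (S.addEdge ⟨f, hf.1⟩).edges) from hg), smul_zero]
          simp only [T]
          rw [dif_neg (fun h => hg h.2)]
    · rw [dif_neg hf, map_zero]
      symm
      refine Finset.sum_eq_zero fun g _ => ?_
      simp only [T]
      rw [dif_neg (fun h => hf h.1)]
  have hanti : ∀ f g, T f g = - T g f := by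
    intro f g
    by_cases h : (f ∈ E(G) ∧ f ∉ S.edges) ∧ (g ∈ E(G) ∧ g ∉ insert f S.edges)
    · have hfg : f ≠ g := by
        rintro rfl
        exact h.2.2 (Finset.mem_insert_self _ _)
      have hg : g ∉ S.edges := fun h' => h.2.2 (Finset.mem_insert_of_mem h')
      have h' : (g ∈ E(G) ∧ g ∉ S.edges) ∧ (f ∈ E(G) ∧ f ∉ insert g S.edges) :=
        ⟨⟨h.2.1, hg⟩, h.1.1, by simp [hfg, h.1.2]⟩
      simp only [T]
      rw [dif_pos h, dif_pos h', ← neg_smul]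
      have hv : (S.Vanishes f ∨ (S.addEdge ⟨f, h.1.1⟩).Vanishes g) ↔
          (S.Vanishes g ∨ (S.addEdge ⟨g, h'.1.1⟩).Vanishes f) := by
        have h1 := S.vanishes_addEdge_iff ⟨f, h.1.1⟩ ⟨g, h'.1.1⟩
        have h2 := S.vanishes_addEdge_iff ⟨g, h'.1.1⟩ ⟨f, h.1.1⟩
        simp only at h1 h2
        rw [h1, h2, Finset.insert_comm]
      congr 1
      · rw [Finset.filter_insert, Finset.filter_insert]
        rcases lt_or_gt_of_ne hfg with hlt | hlt
        · rw [if_pos hlt, if_neg hlt.not_gt, Finset.card_insert_of_notMem (by simp [h.1.2])]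
          ring
        · rw [if_neg hlt.not_gt, if_pos hlt, Finset.card_insert_of_notMem (by simp [hg])]
          ring
      · rw [S.addEdge_comm ⟨f, h.1.1⟩ ⟨g, h'.1.1⟩]
        by_cases hw : S.Vanishes f ∨ (S.addEdge ⟨f, h.1.1⟩).Vanishes g
        · rw [if_pos hw, if_pos (hv.1 hw)]
        · rw [if_neg hw, if_neg (fun hw' => hw (hv.2 hw'))]
    · have h' : ¬ ((g ∈ E(G) ∧ g ∉ S.edges) ∧ (f ∈ E(G) ∧ f ∉ insert g S.edges)) := by
        simp only [Finset.mem_insert, not_or] at h ⊢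
        tauto
      simp only [T]
      rw [dif_neg h, dif_neg h', neg_zero]
  rw [hT]
  have hneg : ∑ f, ∑ g, T f g = - ∑ f, ∑ g, T f g := by
    conv_lhs => rw [Finset.sum_comm]
    rw [← Finset.sum_neg_distrib]
    refine Finset.sum_congr rfl fun f _ => ?_
    rw [← Finset.sum_neg_distrib]
    exact Finset.sum_congr rfl fun g _ => hanti g f
  exact self_eq_neg.1 hneg

end Complex

section Homology

variable {M N : Type*} [AddCommGroup M] [AddCommGroup N]

/-- For an endomorphism `d` and submodules `P`, `Q` (two consecutive terms of a complex): the
kernel of `d` on `Q` modulo the image of `P` under `d`. -/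
abbrev homologyAt (d : M →ₗ[ℤ] M) (P Q : Submodule ℤ M) : Type _ :=
  ↥(Q ⊓ LinearMap.ker d) ⧸ (P.map d).submoduleOf (Q ⊓ LinearMap.ker d)

/-- The map induced on homology by a linear map that commutes with the differentials and respects
the chosen terms of the complexes. -/
def homologyAtMap {d : M →ₗ[ℤ] M} {d' : N →ₗ[ℤ] N} {P Q : Submodule ℤ M} {P' Q' : Submodule ℤ N}
    (φ : M →ₗ[ℤ] N) (hd : φ ∘ₗ d = d' ∘ₗ φ) (hP : P ≤ P'.comap φ) (hQ : Q ≤ Q'.comap φ) :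
    homologyAt d P Q →ₗ[ℤ] homologyAt d' P' Q' :=
  Submodule.mapQ _ _
    (φ.restrict (p := Q ⊓ LinearMap.ker d) (q := Q' ⊓ LinearMap.ker d') (by
      rintro z ⟨hz, hz'⟩
      refine ⟨hQ hz, ?_⟩
      have := LinearMap.congr_fun hd z
      change d z = 0 at hz'
      change d' (φ z) = 0
      simp only [LinearMap.comp_apply, hz', map_zero] at this
      exact this.symm))
    (by
      rintro ⟨z, hz⟩ ⟨p, hp, hpz⟩
      exact ⟨φ p, hP hp, by
        have := LinearMap.congr_fun hd p
        simp only [LinearMap.comp_apply] at this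
        rw [← this, hpz]; rfl⟩)

variable {α β : Type*} [LinearOrder β] [Fintype β]

/-- `H^{i,j}(G)`. -/
abbrev bigradedHomology (G : Graph α β) (i j : ℤ) : Type _ :=
  homologyAt (differential G) (bigradedPart G (i - 1) j) (bigradedPart G i j)

/-- `H^i(G)`. -/
abbrev gradedHomology (G : Graph α β) (i : ℤ) : Type _ :=
  homologyAt (differential G) (gradedPart G (i - 1)) (gradedPart G i)

end Homology

/-! ### Deletion and contraction -/

section DeletionContraction

variable {α β : Type*}

/-- The deletion `G - e`. -/
abbrev deletion (G : Graph α β) (e : β) : Graph α β := G.deleteEdges {e}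

open Classical in
/-- The map that moves the vertex `b` to the vertex `a`. -/
def collapse (a b v : α) : α := if v = b then a else v

/-- The contraction `G / e`, for an edge `e` with ends `a` and `b`: delete `e` and identify `b` with
`a`. The other edges of `G` are kept, so parallel edges may arise. -/
abbrev contraction (G : Graph α β) (e : β) (a b : α) : Graph α β :=
  (G.deleteEdges {e}).map (collapse a b)

/-- The vertex of `G / e` that a vertex of `G` becomes. -/
def toContraction (G : Graph α β) (e : β) (a b : α) (v : V(G)) : V(contraction G e a b) :=
  ⟨collapse a b v, by
    rw [Graph.vertexSet_map]
    exact ⟨v, by simp, rfl⟩⟩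

variable {G : Graph α β} {e : β} {a b : α}

lemma toContraction_surjective (G : Graph α β) (e : β) (a b : α) :
    Function.Surjective (toContraction G e a b) := by
  rintro ⟨w, hw⟩
  rw [Graph.vertexSet_map] at hw
  obtain ⟨v, hv, rfl⟩ := hw
  exact ⟨⟨v, by simpa using hv⟩, rfl⟩

lemma collapse_mem (he : G.IsLink e a b) {v : α} (hv : v ∈ V(G)) : collapse a b v ∈ V(G) := by
  unfold collapse
  split_ifs
  · exact he.left_mem
  · exact hv

lemma collapse_eq (he : G.IsLink e a b) {u v : α} (h : G.IsLink e u v) :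
    collapse a b u = collapse a b v := by
  rcases he.eq_and_eq_or_eq_and_eq h with ⟨rfl, rfl⟩ | ⟨rfl, rfl⟩ <;> simp [collapse]

variable [DecidableEq β]

lemma component_collapse (he : G.IsLink e a b) (s : Finset β) (v : V(G)) :
    component G (insert e s) ⟨collapse a b v, collapse_mem he v.2⟩ =
      component G (insert e s) v := by
  by_cases hv : (v : α) = b
  · apply Quot.sound
    refine ⟨e, by simp, ?_⟩
    simpa [collapse, hv] using he
  · congr 1
    ext
    simp [collapse, hv]

lemma component_toContraction_iff (he : G.IsLink e a b) (s : Finset β) (hs : e ∉ s) (u v : V(G)) :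
    component (contraction G e a b) s (toContraction G e a b u) =
        component (contraction G e a b) s (toContraction G e a b v) ↔
      component G (insert e s) u = component G (insert e s) v := by
  constructor
  · intro h
    have key : ∀ w : V(contraction G e a b), (w : α) ∈ V(G) := by
      intro w
      obtain ⟨v, rfl⟩ := toContraction_surjective G e a b w
      exact collapse_mem he v.2
    let φ : Component (contraction G e a b) s → Component G (insert e s) :=
      Quot.lift (fun w => component G (insert e s) ⟨w, key w⟩) (by
        rintro ⟨w, hw⟩ ⟨w', hw'⟩ ⟨f, hf, p, q, hpq, hp, hq⟩
        simp only at hp hq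
        subst hp hq
        have hpq' : G.IsLink f p q := by
          have := hpq
          simp only [Graph.deleteEdges_isLink] at this
          exact this.1
        have h1 := component_collapse he s ⟨p, hpq'.left_mem⟩
        have h2 := component_collapse he s ⟨q, hpq'.right_mem⟩
        simp only at h1 h2 ⊢
        rw [h1, h2]
        exact Quot.sound ⟨f, by simpa using Or.inr hf, hpq'⟩)
    have := congrArg φ h
    change component G (insert e s) ⟨collapse a b u, _⟩ =
      component G (insert e s) ⟨collapse a b v, _⟩ at this
    rwa [component_collapse he s u, component_collapse he s v] at this
  · intro h
    let φ : Component G (insert e s) → Component (contraction G e a b) s :=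
      Quot.lift (fun w => component (contraction G e a b) s (toContraction G e a b w)) (by
        rintro u v ⟨f, hf, huv⟩
        by_cases hfe : f = e
        · subst hfe
          congr 1
          exact Subtype.ext (collapse_eq he huv)
        · have hf : f ∈ s := (Finset.mem_insert.1 (Finset.mem_coe.1 hf)).resolve_left hfe
          refine Quot.sound ⟨f, hf, u, v, ?_, rfl, rfl⟩
          simp only [Graph.deleteEdges_isLink]
          exact ⟨huv, hfe⟩)
    exact congrArg φ h

lemma notMem_edges_contraction (S : EnhancedState (contraction G e a b)) : e ∉ S.edges := by
  intro h
  have := S.edges_subset h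
  simp at this

/-- The enhanced state `(s ∪ {e}, c̃)` of `G` that belongs to the enhanced state `(s, c)` of
`G / e`: every component of `[G : s ∪ {e}]` has the colour of its image in `G / e`. -/
def liftState (he : G.IsLink e a b) (S : EnhancedState (contraction G e a b)) :
    EnhancedState G where
  edges := insert e S.edges
  edges_subset := by
    intro g hg
    rcases Finset.mem_insert.1 (Finset.mem_coe.1 hg) with rfl | h
    · exact he.edge_mem
    · have := S.edges_subset h
      simp at this
      exact this.1
  colour v := S.colour (toContraction G e a b v)
  colour_eq u v h := S.colour_eq_of_component_eq
    ((component_toContraction_iff he _ (notMem_edges_contraction S) u v).2 (Quot.sound h))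

lemma xCount_liftState (he : G.IsLink e a b) (S : EnhancedState (contraction G e a b)) :
    (liftState he S).xCount = S.xCount := by
  have hs := notMem_edges_contraction S
  let φ : Component G (insert e S.edges) → Component (contraction G e a b) S.edges :=
    Quot.lift (fun w => component (contraction G e a b) S.edges (toContraction G e a b w))
      (fun u v h => (component_toContraction_iff he _ hs u v).2 (Quot.sound h))
  have hφ : Function.Bijective φ := by
    constructor
    · rintro ⟨u⟩ ⟨v⟩ h
      exact (component_toContraction_iff he _ hs u v).1 h
    · rintro ⟨w⟩
      obtain ⟨v, rfl⟩ := toContraction_surjective G e a b w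
      exact ⟨component G _ v, rfl⟩
  refine Nat.card_congr (Equiv.subtypeEquiv (Equiv.ofBijective φ hφ) ?_)
  rintro ⟨v⟩
  exact Iff.rfl

/-- `β` on states: `(s, c)` with `e ∉ s` as an enhanced state of `G - e`. -/
def restrictState (S : EnhancedState G) (hS : e ∉ S.edges) : EnhancedState (deletion G e) where
  edges := S.edges
  edges_subset := by
    intro f hf
    simp only [Graph.edgeSet_deleteEdges]
    exact ⟨S.edges_subset hf, by rintro rfl; exact hS hf⟩
  colour v := S.colour ⟨v, by simpa using v.2⟩
  colour_eq := by
    rintro u v ⟨f, hf, h⟩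
    simp only [Graph.deleteEdges_isLink] at h
    exact S.colour_eq _ _ ⟨f, hf, h.1⟩

lemma component_deletion_iff (s : Finset β) (hs : e ∉ s) (u v : V(deletion G e)) :
    component (deletion G e) s u = component (deletion G e) s v ↔
      component G s ⟨u, by simpa using u.2⟩ = component G s ⟨v, by simpa using v.2⟩ := by
  constructor
  · intro h
    let φ : Component (deletion G e) s → Component G s :=
      Quot.lift (fun w => component G s ⟨w, by simpa using w.2⟩) (by
        rintro u v ⟨f, hf, h⟩
        simp only [Graph.deleteEdges_isLink] at h
        exact Quot.sound ⟨f, hf, h.1⟩)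
    exact congrArg φ h
  · intro h
    let φ : Component G s → Component (deletion G e) s :=
      Quot.lift (fun w => component (deletion G e) s ⟨w, by simp⟩) (by
        rintro u v ⟨f, hf, h⟩
        refine Quot.sound ⟨f, hf, ?_⟩
        simp only [Graph.deleteEdges_isLink]
        exact ⟨h, by rintro rfl; exact hs hf⟩)
    exact congrArg φ h

lemma xCount_restrictState (S : EnhancedState G) (hS : e ∉ S.edges) :
    (restrictState S hS).xCount = S.xCount := by
  let φ : Component (deletion G e) S.edges → Component G S.edges :=
    Quot.lift (fun w => component G S.edges ⟨w, by simpa using w.2⟩)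
      (fun u v h => (component_deletion_iff _ hS u v).1 (Quot.sound h))
  have hφ : Function.Bijective φ := by
    constructor
    · rintro ⟨u⟩ ⟨v⟩ h
      exact (component_deletion_iff _ hS u v).2 h
    · rintro ⟨w⟩
      exact ⟨component _ _ ⟨w, by simp⟩, rfl⟩
  refine Nat.card_congr (Equiv.subtypeEquiv (Equiv.ofBijective φ hφ) ?_)
  rintro ⟨v⟩
  exact Iff.rfl

end DeletionContraction

section ChainMaps

variable {α β : Type*} [LinearOrder β] {G : Graph α β} {e : β} {a b : α}

/-- The map `α : C^{i,j}(G / e) → C^{i+1,j}(G)`, which sends `(s, c)` to `± (s ∪ {e}, c̃)`. The sign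
is `(-1)` to the number of edges of `s` that come after `e`; it makes `α` commute with the
differentials, and it is `+1` if `e` is the last edge of `G`. -/
def alpha (he : G.IsLink e a b) : Cochain (contraction G e a b) →ₗ[ℤ] Cochain G :=
  Finsupp.linearCombination ℤ fun S =>
    (-1 : ℤ) ^ (S.edges.filter (e < ·)).card • Finsupp.single (liftState he S) 1

/-- The map `β : C^{i,j}(G) → C^{i,j}(G - e)`, which sends `S = (s, c)` to `S` if `e ∉ s` and to `0`
if `e ∈ s`. -/
def beta (G : Graph α β) (e : β) : Cochain G →ₗ[ℤ] Cochain (deletion G e) :=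
  Finsupp.linearCombination ℤ fun S =>
    if hS : e ∈ S.edges then 0 else Finsupp.single (restrictState S hS) 1

lemma alpha_single (he : G.IsLink e a b) (S : EnhancedState (contraction G e a b)) :
    alpha he (Finsupp.single S 1) =
      (-1 : ℤ) ^ (S.edges.filter (e < ·)).card • Finsupp.single (liftState he S) 1 := by
  simp [alpha]

lemma beta_single (S : EnhancedState G) :
    beta G e (Finsupp.single S 1) =
      if hS : e ∈ S.edges then 0 else Finsupp.single (restrictState S hS) 1 := by
  simp [beta]

lemma card_edges_liftState (he : G.IsLink e a b) (S : EnhancedState (contraction G e a b)) :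
    (liftState he S).edges.card = S.edges.card + 1 :=
  Finset.card_insert_of_notMem (notMem_edges_contraction S)

lemma alpha_bigradedPart (he : G.IsLink e a b) {i k j : ℤ} (hk : i + 1 = k) :
    bigradedPart (contraction G e a b) i j ≤ (bigradedPart G k j).comap (alpha he) := by
  apply supported_le_comap
  rintro S ⟨h1, h2⟩
  rw [alpha_single]
  refine Submodule.smul_mem _ _ (Finsupp.single_mem_supported _ _ ⟨?_, ?_⟩)
  · rw [card_edges_liftState]; push_cast; omega
  · rw [xCount_liftState]; exact h2

lemma alpha_gradedPart (he : G.IsLink e a b) {i k : ℤ} (hk : i + 1 = k) :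
    gradedPart (contraction G e a b) i ≤ (gradedPart G k).comap (alpha he) := by
  apply supported_le_comap
  intro S h1
  rw [alpha_single]
  refine Submodule.smul_mem _ _ (Finsupp.single_mem_supported _ _ ?_)
  change ((liftState he S).edges.card : ℤ) = k
  change (S.edges.card : ℤ) = i at h1
  rw [card_edges_liftState]; push_cast; omega

lemma beta_bigradedPart (G : Graph α β) (e : β) (i j : ℤ) :
    bigradedPart G i j ≤ (bigradedPart (deletion G e) i j).comap (beta G e) := by
  apply supported_le_comap
  rintro S ⟨h1, h2⟩
  rw [beta_single]
  split_ifs with hS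
  · exact Submodule.zero_mem _
  · refine Finsupp.single_mem_supported _ _ ⟨h1, ?_⟩
    rw [xCount_restrictState]; exact h2

lemma beta_gradedPart (G : Graph α β) (e : β) (i : ℤ) :
    gradedPart G i ≤ (gradedPart (deletion G e) i).comap (beta G e) := by
  apply supported_le_comap
  intro S h1
  rw [beta_single]
  split_ifs with hS
  · exact Submodule.zero_mem _
  · exact Finsupp.single_mem_supported _ _ h1

lemma vanishes_liftState (he : G.IsLink e a b) (S : EnhancedState (contraction G e a b)) (f : β)
    (hf : f ≠ e) : (liftState he S).Vanishes f ↔ S.Vanishes f := by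
  have hs := notMem_edges_contraction S
  have hs' : e ∉ insert f S.edges := by simp [hs, hf.symm]
  constructor
  · rintro ⟨u, v, hu, hv, h1, h2⟩
    refine ⟨toContraction G e a b u, toContraction G e a b v, hu, hv, ?_, ?_⟩
    · rw [component_toContraction_iff he _ hs', Finset.insert_comm]
      exact h1
    · rw [Ne, component_toContraction_iff he _ hs]
      exact h2
  · rintro ⟨u, v, hu, hv, h1, h2⟩
    obtain ⟨u, rfl⟩ := toContraction_surjective G e a b u
    obtain ⟨v, rfl⟩ := toContraction_surjective G e a b v
    refine ⟨u, v, hu, hv, ?_, ?_⟩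
    · rw [component_toContraction_iff he _ hs', Finset.insert_comm] at h1
      exact h1
    · rw [Ne, component_toContraction_iff he _ hs] at h2
      exact h2

lemma addEdge_liftState (he : G.IsLink e a b) (S : EnhancedState (contraction G e a b)) (f : β)
    (hfG : f ∈ E(G)) (hf' : f ∈ E(contraction G e a b)) (hf : f ≠ e) :
    (liftState he S).addEdge ⟨f, hfG⟩ = liftState he (S.addEdge ⟨f, hf'⟩) := by
  have hs' : e ∉ insert f S.edges := by simp [notMem_edges_contraction S, hf.symm]
  apply EnhancedState.ext
  · exact Finset.insert_comm _ _ _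
  · funext v
    simp only [EnhancedState.addEdge, liftState]
    congr 1
    rw [(toContraction_surjective G e a b).exists]
    simp only [component_toContraction_iff he _ hs']
    rw [Finset.insert_comm]

lemma vanishes_restrictState (S : EnhancedState G) (hS : e ∉ S.edges) (f : β) (hf : f ≠ e) :
    (restrictState S hS).Vanishes f ↔ S.Vanishes f := by
  have hs' : e ∉ insert f S.edges := by simp [hS, hf.symm]
  constructor
  · rintro ⟨u, v, hu, hv, h1, h2⟩
    exact ⟨_, _, hu, hv, (component_deletion_iff _ hs' u v).1 h1,
      fun h => h2 ((component_deletion_iff _ hS u v).2 h)⟩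
  · rintro ⟨u, v, hu, hv, h1, h2⟩
    refine ⟨⟨u, by simp⟩, ⟨v, by simp⟩, hu, hv, (component_deletion_iff _ hs' _ _).2 h1,
      fun h => h2 ((component_deletion_iff _ hS _ _).1 h)⟩

lemma addEdge_restrictState (S : EnhancedState G) (hS : e ∉ S.edges) (f : β)
    (hfG : f ∈ E(G)) (hf' : f ∈ E(deletion G e)) (hf : f ≠ e)
    (hS' : e ∉ (S.addEdge ⟨f, hfG⟩).edges) :
    (restrictState S hS).addEdge ⟨f, hf'⟩ = restrictState (S.addEdge ⟨f, hfG⟩) hS' := by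
  have hs' : e ∉ insert f S.edges := by simp [hS, hf.symm]
  apply EnhancedState.ext
  · rfl
  · funext v
    simp only [EnhancedState.addEdge, restrictState]
    congr 1
    have hsurj : Function.Surjective (fun w : V(deletion G e) => (⟨w, by simpa using w.2⟩ : V(G))) :=
      fun w => ⟨⟨w, by simp⟩, rfl⟩
    rw [hsurj.exists]
    simp only [component_deletion_iff _ hs']

variable [Fintype β]

lemma alpha_addEdgeCochain (he : G.IsLink e a b) (S : EnhancedState (contraction G e a b)) (f : β)
    (hfG : f ∈ E(G)) (hf' : f ∈ E(contraction G e a b)) (hf : f ≠ e) :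
    alpha he (addEdgeCochain S ⟨f, hf'⟩) =
      (-1 : ℤ) ^ ((insert f S.edges).filter (e < ·)).card •
        addEdgeCochain (liftState he S) ⟨f, hfG⟩ := by
  unfold addEdgeCochain
  have hv := vanishes_liftState he S f hf
  by_cases h : S.Vanishes f
  · rw [if_pos h, if_pos (hv.2 h), map_zero, smul_zero]
  · rw [if_neg h, if_neg (fun h' => h (hv.1 h')), alpha_single,
      addEdge_liftState he S f hfG hf' hf]
    rfl

lemma alpha_comp_differential (he : G.IsLink e a b) :
    alpha he ∘ₗ differential (contraction G e a b) = differential G ∘ₗ alpha he := by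
  refine Finsupp.lhom_ext' fun S => LinearMap.ext_ring ?_
  simp only [LinearMap.comp_apply, Finsupp.lsingle_apply]
  rw [differential_single, alpha_single, map_smul, differential_single]
  simp only [stateDifferential, map_sum, Finset.smul_sum]
  refine Finset.sum_congr rfl fun f _ => ?_
  have hiff : (f ∈ E(contraction G e a b) ∧ f ∉ S.edges) ↔
      (f ∈ E(G) ∧ f ∉ (liftState he S).edges) := by
    have : (liftState he S).edges = insert e S.edges := rfl
    simp [this, and_assoc]
  by_cases h : f ∈ E(contraction G e a b) ∧ f ∉ S.edges
  · have h' := hiff.1 h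
    have hfe : f ≠ e := by
      rintro rfl
      exact h'.2 (Finset.mem_insert_self _ _)
    rw [dif_pos h, dif_pos h', map_smul, alpha_addEdgeCochain he S f h'.1 h.1 hfe, smul_smul,
      smul_smul]
    congr 1
    have : (liftState he S).edges = insert e S.edges := rfl
    rw [this, Finset.filter_insert, Finset.filter_insert]
    split_ifs with hlt
    · rw [Finset.card_insert_of_notMem (by simp [h.2]),
        Finset.card_insert_of_notMem (by simp [notMem_edges_contraction S])]
      ring
    · ring
  · rw [dif_neg h, dif_neg (fun h' => h (hiff.2 h')), map_zero, smul_zero]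

lemma beta_addEdgeCochain (S : EnhancedState G) (hS : e ∉ S.edges) (f : β)
    (hfG : f ∈ E(G)) (hf' : f ∈ E(deletion G e)) (hf : f ≠ e) :
    beta G e (addEdgeCochain S ⟨f, hfG⟩) = addEdgeCochain (restrictState S hS) ⟨f, hf'⟩ := by
  have hs' : e ∉ (S.addEdge ⟨f, hfG⟩).edges := by
    change e ∉ insert f S.edges
    simp [hS, hf.symm]
  unfold addEdgeCochain
  have hv := vanishes_restrictState S hS f hf
  by_cases h : S.Vanishes f
  · rw [if_pos h, if_pos (hv.2 h), map_zero]
  · rw [if_neg h, if_neg (fun h' => h (hv.1 h')), beta_single, dif_neg hs', addEdge_restrictState S hS f hfG hf' hf]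

lemma beta_addEdgeCochain_of_mem (S : EnhancedState G) (f : E(G))
    (h : e ∈ insert (f : β) S.edges) : beta G e (addEdgeCochain S f) = 0 := by
  unfold addEdgeCochain
  split_ifs
  · simp
  · rw [beta_single]
    exact dif_pos h

lemma beta_comp_differential (G : Graph α β) (e : β) :
    beta G e ∘ₗ differential G = differential (deletion G e) ∘ₗ beta G e := by
  refine Finsupp.lhom_ext' fun S => LinearMap.ext_ring ?_
  simp only [LinearMap.comp_apply, Finsupp.lsingle_apply]
  rw [differential_single, beta_single]
  by_cases hS : e ∈ S.edges
  · rw [dif_pos hS, map_zero]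
    simp only [stateDifferential, map_sum]
    refine Finset.sum_eq_zero fun f _ => ?_
    split_ifs with h
    · rw [map_smul, beta_addEdgeCochain_of_mem _ _ (Finset.mem_insert_of_mem hS), smul_zero]
    · simp
  · rw [dif_neg hS, differential_single]
    simp only [stateDifferential, map_sum]
    refine Finset.sum_congr rfl fun f _ => ?_
    by_cases hfe : f = e
    · subst hfe
      rw [dif_neg (c := f ∈ E(deletion G f) ∧ _) (by simp)]
      split_ifs with h
      · rw [map_smul, beta_addEdgeCochain_of_mem (e := f) S ⟨f, h.1⟩ (Finset.mem_insert_self _ _),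
          smul_zero]
      · simp
    · by_cases h : f ∈ E(G) ∧ f ∉ S.edges
      · have h' : f ∈ E(deletion G e) ∧ f ∉ (restrictState S hS).edges := by
          refine ⟨?_, h.2⟩
          simp [h.1, hfe]
        rw [dif_pos h, dif_pos h', map_smul, beta_addEdgeCochain S hS f h.1 h'.1 hfe]
        rfl
      · have h' : ¬ (f ∈ E(deletion G e) ∧ f ∉ (restrictState S hS).edges) := by
          rintro ⟨h1, h2⟩
          refine h ⟨?_, h2⟩
          simp at h1
          exact h1.1
        rw [dif_neg h, dif_neg h', map_zero]

/-- `α* : H^{i,j}(G / e) → H^{i+1,j}(G)`. -/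
def alphaStar (he : G.IsLink e a b) (i j : ℤ) :
    bigradedHomology (contraction G e a b) i j →ₗ[ℤ] bigradedHomology G (i + 1) j :=
  homologyAtMap (alpha he) (alpha_comp_differential he)
    (alpha_bigradedPart he (by ring)) (alpha_bigradedPart he rfl)

/-- `β* : H^{i,j}(G) → H^{i,j}(G - e)`. -/
def betaStar (G : Graph α β) (e : β) (i j : ℤ) :
    bigradedHomology G i j →ₗ[ℤ] bigradedHomology (deletion G e) i j :=
  homologyAtMap (beta G e) (beta_comp_differential G e)
    (beta_bigradedPart G e _ _) (beta_bigradedPart G e _ _)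

/-- `α* : H^i(G / e) → H^{i+1}(G)`. -/
def alphaStarTotal (he : G.IsLink e a b) (i : ℤ) :
    gradedHomology (contraction G e a b) i →ₗ[ℤ] gradedHomology G (i + 1) :=
  homologyAtMap (alpha he) (alpha_comp_differential he)
    (alpha_gradedPart he (by ring)) (alpha_gradedPart he rfl)

/-- `β* : H^i(G) → H^i(G - e)`. -/
def betaStarTotal (G : Graph α β) (e : β) (i : ℤ) :
    gradedHomology G i →ₗ[ℤ] gradedHomology (deletion G e) i :=
  homologyAtMap (beta G e) (beta_comp_differential G e)
    (beta_gradedPart G e _) (beta_gradedPart G e _)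

end ChainMaps

/-- `0 → A → B → C → 0` is a split short exact sequence. -/
def IsSplitExact {A B C : Type*} [AddCommGroup A] [AddCommGroup B] [AddCommGroup C]
    (f : A →ₗ[ℤ] B) (g : B →ₗ[ℤ] C) : Prop :=
  Function.Injective f ∧ Function.Exact f g ∧ Function.Surjective g ∧
    ∃ σ : C →ₗ[ℤ] B, g ∘ₗ σ = LinearMap.id

/-! ### The graph `K_{n-1}^m` -/

/-- The pairs `(a, b)`, `a < b`, that are edges of `K_{n-1}^m`. The vertex `k ∈ {1, …, n}` is the
element `k - 1` of `Fin n`: either both ends are among the first `n - 1` vertices, or `b` is the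
last vertex and `a` is one of the first `m` vertices. -/
def IsEdgeK (n m : ℕ) (p : Fin n ×ₗ Fin n) : Prop :=
  (ofLex p).1 < (ofLex p).2 ∧
    (((ofLex p).2 : ℕ) + 1 < n ∨ ((ofLex p).2 : ℕ) + 1 = n ∧ ((ofLex p).1 : ℕ) < m)

/-- The graph `K_{n-1}^m`: the complete graph on the first `n - 1` vertices, together with a last
vertex joined to the first `m` vertices. An edge is the pair `(a, b)` of its ends with `a < b`, and
the edges are ordered lexicographically. -/
def graphK (n m : ℕ) : Graph (Fin n) (Fin n ×ₗ Fin n) where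
  vertexSet := Set.univ
  edgeSet := {p | IsEdgeK n m p}
  IsLink p u v := IsEdgeK n m p ∧ (ofLex p = (u, v) ∨ ofLex p = (v, u))
  isLink_symm p _ := ⟨fun _ _ h => ⟨h.1, h.2.symm⟩⟩
  eq_or_eq_of_isLink_of_isLink := by
    rintro p x y v w ⟨-, h | h⟩ ⟨-, h' | h'⟩ <;> rw [h, Prod.mk.injEq] at h' <;> tauto
  edge_mem_iff_exists_isLink p :=
    ⟨fun h => ⟨(ofLex p).1, (ofLex p).2, h, Or.inl rfl⟩, fun ⟨_, _, h⟩ => h.1⟩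
  left_mem_of_isLink _ _ _ _ := Set.mem_univ _

/-- The edge `{m, n}` of `K_{n-1}^m`. -/
lemma graphK_isLink {n m : ℕ} (hmn : m < n) {a b : Fin n} (ha : (a : ℕ) + 1 = m)
    (hb : (b : ℕ) + 1 = n) : (graphK n m).IsLink (toLex (a, b)) a b := by
  refine ⟨⟨?_, Or.inr ⟨hb, ?_⟩⟩, Or.inl rfl⟩
  · change a < b
    rw [Fin.lt_def]
    omega
  · change (a : ℕ) < m
    omega

end

end ChromaticHomology

/-!
The cochains of `G` are a quotient of the tensor product of the exterior algebra on the edges and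
`ℤ[x_v]/(x_v²)`: the monomial `e_s x_M` represents the state with edges `s` in which the components
meeting `M` are coloured `x`, and the relations are `x_u e_s = x_v e_s` when an edge of `s` joins
`u` and `v`. The differential is multiplication by the sum of all `e_f`.

As `0 → C(G/e) → C(G) → C(G-e) → 0` is exact, it suffices to find a section of `β` that is a chain
map of bidegree `(0, 0)`. For the obvious section the obstruction is multiplication by `e_e`, where
`e = ab`. It is removed in two steps.

* The monomials that contain `e` and a further edge `f = tb` span a contractible subcomplex: there
  is an edge `g = ta`, and since `e`, `f`, `g` form a triangle, removing `g` is a contraction.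
* Modulo this subcomplex, multiplication by `e_e` is `x_a + x_b` followed by the merge map, which
  takes the coefficient of `x_b` when `b` is isolated and adds the edge `e`. On `C(G-e)` the
  comultiplication along an edge `uv` is a null-homotopy of `x_u + x_v`. Hence `x_a + x_b`, being
  `(x_u + x_b) + (x_p + x_a) - (x_u + x_p)`, is null-homotopic if there is a walk `b, u, p, a`.
-/

namespace ChromaticHomology

noncomputable section

section Monomials

/-- The free `ℤ`-module on the monomials `e_s x_M`, the products of the `e_f` with `f ∈ s` and of
the variables `x_v` with `v ∈ M`. A monomial is encoded as the pair `(s, M)`. -/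
abbrev MonomialCochain (V β : Type*) : Type _ := (Finset β × Finset V) →₀ ℤ

variable {V β N : Type*} [AddCommGroup N]

/-- The monomial `e_s x_M`. -/
def monomial (s : Finset β) (M : Finset V) : MonomialCochain V β := Finsupp.single (s, M) 1

/-- The linear map on the monomial cochains with the given values on the monomials. -/
def monomialLift (φ : Finset β → Finset V → N) : MonomialCochain V β →ₗ[ℤ] N :=
  Finsupp.linearCombination ℤ fun p => φ p.1 p.2

@[simp]
lemma monomialLift_monomial (φ : Finset β → Finset V → N) (s : Finset β) (M : Finset V) :
    monomialLift φ (monomial s M) = φ s M := by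
  simp [monomialLift, monomial]

lemma monomial_ext {φ ψ : MonomialCochain V β →ₗ[ℤ] N}
    (h : ∀ s M, φ (monomial s M) = ψ (monomial s M)) : φ = ψ := by
  ext ⟨s, M⟩
  exact h s M

/-- The span of the monomials `e_s x_M` with `(s, M) ∈ T`. -/
def monomialSpan (T : Set (Finset β × Finset V)) : Submodule ℤ (MonomialCochain V β) :=
  Finsupp.supported ℤ ℤ T

lemma monomial_mem_monomialSpan {T : Set (Finset β × Finset V)} {s : Finset β} {M : Finset V}
    (h : (s, M) ∈ T) : monomial s M ∈ monomialSpan T :=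
  Finsupp.single_mem_supported _ _ h

lemma map_mem_of_mem_monomialSpan {T : Set (Finset β × Finset V)} {L : Submodule ℤ N}
    (φ : MonomialCochain V β →ₗ[ℤ] N) (h : ∀ s M, (s, M) ∈ T → φ (monomial s M) ∈ L)
    {z : MonomialCochain V β} (hz : z ∈ monomialSpan T) : φ z ∈ L := by
  suffices monomialSpan T ≤ L.comap φ from this hz
  rw [monomialSpan, Finsupp.supported_eq_span_single, Submodule.span_le]
  rintro _ ⟨⟨s, M⟩, hS, rfl⟩
  exact h s M hS

lemma map_mem_of_forall_monomial {L : Submodule ℤ N} (φ : MonomialCochain V β →ₗ[ℤ] N)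
    (h : ∀ s M, φ (monomial s M) ∈ L) (z : MonomialCochain V β) : φ z ∈ L := by
  refine map_mem_of_mem_monomialSpan (T := Set.univ) φ (fun s M _ => h s M) ?_
  rw [monomialSpan, Finsupp.supported_univ]
  exact Submodule.mem_top

/-- The span of the monomials `e_s x_M` with `s ∈ 𝒮`. -/
def edgeSpan (V : Type*) (𝒮 : Set (Finset β)) : Submodule ℤ (MonomialCochain V β) :=
  monomialSpan (Prod.fst ⁻¹' 𝒮)

lemma monomial_mem_edgeSpan {𝒮 : Set (Finset β)} {s : Finset β} (h : s ∈ 𝒮) (M : Finset V) :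
    monomial s M ∈ edgeSpan V 𝒮 :=
  monomial_mem_monomialSpan h

lemma map_mem_of_mem_edgeSpan {𝒮 : Set (Finset β)} {L : Submodule ℤ N}
    (φ : MonomialCochain V β →ₗ[ℤ] N) (h : ∀ s ∈ 𝒮, ∀ M, φ (monomial s M) ∈ L)
    {z : MonomialCochain V β} (hz : z ∈ edgeSpan V 𝒮) : φ z ∈ L :=
  map_mem_of_mem_monomialSpan φ (fun s M hs => h s hs M) hz

lemma eq_of_mem_edgeSpan {𝒮 : Set (Finset β)} {φ ψ : MonomialCochain V β →ₗ[ℤ] N}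
    (h : ∀ s ∈ 𝒮, ∀ M, φ (monomial s M) = ψ (monomial s M)) {z : MonomialCochain V β}
    (hz : z ∈ edgeSpan V 𝒮) : φ z = ψ z := by
  have := map_mem_of_mem_edgeSpan (L := ⊥) (φ - ψ) (fun s hs M => by simp [h s hs M]) hz
  simpa [sub_eq_zero] using this

lemma edgeSpan_mono {𝒮 𝒯 : Set (Finset β)} (h : 𝒮 ⊆ 𝒯) : edgeSpan V 𝒮 ≤ edgeSpan V 𝒯 :=
  Finsupp.supported_mono (Set.preimage_mono h)

open Classical in
/-- The projection to the monomials `e_s x_M` with `s ∈ 𝒮`. -/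
def edgeProj (V : Type*) (𝒮 : Set (Finset β)) : Module.End ℤ (MonomialCochain V β) :=
  monomialLift fun s M => if s ∈ 𝒮 then monomial s M else 0

lemma edgeProj_monomial_of_mem {𝒮 : Set (Finset β)} {s : Finset β} (h : s ∈ 𝒮) (M : Finset V) :
    edgeProj V 𝒮 (monomial s M) = monomial s M := by
  simp [edgeProj, h]

lemma edgeProj_monomial_of_notMem {𝒮 : Set (Finset β)} {s : Finset β} (h : s ∉ 𝒮)
    (M : Finset V) : edgeProj V 𝒮 (monomial s M) = 0 := by
  simp [edgeProj, h]

lemma edgeProj_eq_self {𝒮 : Set (Finset β)} {z : MonomialCochain V β} (hz : z ∈ edgeSpan V 𝒮) :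
    edgeProj V 𝒮 z = z :=
  eq_of_mem_edgeSpan (ψ := LinearMap.id) (fun _ hs => edgeProj_monomial_of_mem hs) hz

lemma edgeProj_eq_zero {𝒮 : Set (Finset β)} {z : MonomialCochain V β} (hz : z ∈ edgeSpan V 𝒮ᶜ) :
    edgeProj V 𝒮 z = 0 :=
  eq_of_mem_edgeSpan (ψ := 0) (fun _ hs => edgeProj_monomial_of_notMem hs) hz

lemma edgeProj_mem_edgeSpan (𝒮 : Set (Finset β)) (z : MonomialCochain V β) :
    edgeProj V 𝒮 z ∈ edgeSpan V 𝒮 := by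
  refine map_mem_of_forall_monomial _ (fun s M => ?_) z
  by_cases h : s ∈ 𝒮
  · rw [edgeProj_monomial_of_mem h]
    exact monomial_mem_edgeSpan h M
  · rw [edgeProj_monomial_of_notMem h]
    exact Submodule.zero_mem _

lemma edgeProj_mem_edgeSpan_of_mem (𝒮 : Set (Finset β)) {𝒯 : Set (Finset β)}
    {z : MonomialCochain V β} (hz : z ∈ edgeSpan V 𝒯) : edgeProj V 𝒮 z ∈ edgeSpan V 𝒯 := by
  refine map_mem_of_mem_edgeSpan _ (fun s hs M => ?_) hz
  by_cases h : s ∈ 𝒮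
  · rw [edgeProj_monomial_of_mem h]
    exact monomial_mem_edgeSpan hs M
  · rw [edgeProj_monomial_of_notMem h]
    exact Submodule.zero_mem _

section Variables

variable [DecidableEq V]

/-- Multiplication by the variable `x_v`, with `x_v² = 0`. -/
def mulVar (β : Type*) (v : V) : Module.End ℤ (MonomialCochain V β) :=
  monomialLift fun s M => if v ∈ M then 0 else monomial s (insert v M)

/-- The coefficient of the variable `x_v`, that is, the partial derivative with respect to `x_v`. -/
def coeffVar (β : Type*) (v : V) : Module.End ℤ (MonomialCochain V β) :=
  monomialLift fun s M => if v ∈ M then monomial s (M.erase v) else 0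

lemma mulVar_monomial (v : V) (s : Finset β) (M : Finset V) :
    mulVar β v (monomial s M) = if v ∈ M then 0 else monomial s (insert v M) := by
  simp [mulVar]

lemma coeffVar_monomial (v : V) (s : Finset β) (M : Finset V) :
    coeffVar β v (monomial s M) = if v ∈ M then monomial s (M.erase v) else 0 := by
  simp [coeffVar]

lemma mulVar_mul_self (v : V) : mulVar β v * mulVar β v = 0 := by
  refine monomial_ext fun s M => ?_
  by_cases h : v ∈ M <;> simp [mulVar_monomial, h]

lemma commute_mulVar_mulVar (u v : V) : Commute (mulVar β u) (mulVar β v) := by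
  rcases eq_or_ne u v with rfl | huv
  · rfl
  refine monomial_ext fun s M => ?_
  by_cases h : v ∈ M <;> by_cases h' : u ∈ M <;>
    simp [mulVar_monomial, h, h', huv, huv.symm, Finset.insert_comm]

lemma commute_coeffVar_mulVar {u v : V} (huv : u ≠ v) :
    Commute (coeffVar β u) (mulVar β v) := by
  refine monomial_ext fun s M => ?_
  by_cases h : v ∈ M <;> by_cases h' : u ∈ M <;>
    simp [mulVar_monomial, coeffVar_monomial, h, h', huv, huv.symm, Finset.erase_insert_of_ne]

lemma coeffVar_mul_mulVar_self (v : V) :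
    coeffVar β v * mulVar β v = 1 - mulVar β v * coeffVar β v := by
  refine monomial_ext fun s M => ?_
  by_cases h : v ∈ M <;> simp [mulVar_monomial, coeffVar_monomial, h]

lemma commute_edgeProj_mulVar (𝒮 : Set (Finset β)) (v : V) :
    Commute (edgeProj V 𝒮) (mulVar β v) := by
  refine monomial_ext fun s M => ?_
  by_cases hs : s ∈ 𝒮 <;> by_cases h : v ∈ M <;> simp [edgeProj, mulVar_monomial, hs, h]

lemma mulVar_mem_edgeSpan {𝒮 : Set (Finset β)} (v : V) {z : MonomialCochain V β}
    (hz : z ∈ edgeSpan V 𝒮) : mulVar β v z ∈ edgeSpan V 𝒮 := by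
  refine map_mem_of_mem_edgeSpan _ (fun s hs M => ?_) hz
  rw [mulVar_monomial]
  split_ifs
  · exact Submodule.zero_mem _
  · exact monomial_mem_edgeSpan hs _

lemma coeffVar_mem_edgeSpan {𝒮 : Set (Finset β)} (v : V) {z : MonomialCochain V β}
    (hz : z ∈ edgeSpan V 𝒮) : coeffVar β v z ∈ edgeSpan V 𝒮 := by
  refine map_mem_of_mem_edgeSpan _ (fun s hs M => ?_) hz
  rw [coeffVar_monomial]
  split_ifs
  · exact monomial_mem_edgeSpan hs _
  · exact Submodule.zero_mem _

end Variables

section Edges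

variable [LinearOrder β]

/-- The sign `(-1)^{n(f)}`, where `n(f)` is the number of elements of `s` that precede `f`. -/
def edgeSign (f : β) (s : Finset β) : ℤ := (-1) ^ (s.filter (· < f)).card

@[simp]
lemma edgeSign_mul_self (f : β) (s : Finset β) : edgeSign f s * edgeSign f s = 1 := by
  rw [edgeSign, ← mul_pow]
  simp

@[simp]
lemma edgeSign_insert_self (f : β) (s : Finset β) : edgeSign f (insert f s) = edgeSign f s := by
  simp [edgeSign, Finset.filter_insert]

@[simp]
lemma edgeSign_erase_self (f : β) (s : Finset β) : edgeSign f (s.erase f) = edgeSign f s := by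
  simp [edgeSign, Finset.filter_erase]

lemma edgeSign_insert {f g : β} {s : Finset β} (hg : g ∉ s) :
    edgeSign f (insert g s) = (if g < f then -1 else 1) * edgeSign f s := by
  unfold edgeSign
  rw [Finset.filter_insert]
  split_ifs with h
  · rw [Finset.card_insert_of_notMem (by simp [hg]), pow_succ]
    ring
  · simp

lemma edgeSign_insert_mul_edgeSign_insert {f g : β} {s : Finset β} (hfg : f ≠ g) (hf : f ∉ s)
    (hg : g ∉ s) :
    edgeSign f (insert g s) * edgeSign g (insert f s) = -(edgeSign f s * edgeSign g s) := by
  rw [edgeSign_insert hf, edgeSign_insert hg]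
  rcases lt_or_gt_of_ne hfg with h | h
  · rw [if_neg h.not_gt, if_pos h]
    ring
  · rw [if_pos h, if_neg h.not_gt]
    ring

lemma edgeSign_mul_edgeSign_insert {f g : β} {s : Finset β} (hfg : f ≠ g) (hf : f ∉ s)
    (hg : g ∉ s) : edgeSign f s * edgeSign g (insert f s) =
      -(edgeSign g s * edgeSign f (insert g s)) := by
  rw [edgeSign_insert hf, edgeSign_insert hg]
  rcases lt_or_gt_of_ne hfg with h | h
  · rw [if_neg h.not_gt, if_pos h]
    ring
  · rw [if_pos h, if_neg h.not_gt]
    ring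

variable (V) in
/-- Left multiplication by `e_f`, with the signs of the exterior algebra. -/
def mulEdge (f : β) : Module.End ℤ (MonomialCochain V β) :=
  monomialLift fun s M => if f ∈ s then 0 else edgeSign f s • monomial (insert f s) M

variable (V) in
/-- The interior product with the dual of `e_f`, which removes `f`. -/
def removeEdge (f : β) : Module.End ℤ (MonomialCochain V β) :=
  monomialLift fun s M => if f ∈ s then edgeSign f s • monomial (s.erase f) M else 0

lemma mulEdge_monomial (f : β) (s : Finset β) (M : Finset V) :
    mulEdge V f (monomial s M) =
      if f ∈ s then 0 else edgeSign f s • monomial (insert f s) M := by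
  simp [mulEdge]

lemma removeEdge_monomial (f : β) (s : Finset β) (M : Finset V) :
    removeEdge V f (monomial s M) =
      if f ∈ s then edgeSign f s • monomial (s.erase f) M else 0 := by
  simp [removeEdge]

lemma mulEdge_mul_mulEdge (f g : β) :
    mulEdge V f * mulEdge V g = -(mulEdge V g * mulEdge V f) := by
  refine monomial_ext fun s M => ?_
  rcases eq_or_ne f g with rfl | hfg
  · by_cases h : f ∈ s <;> simp [mulEdge_monomial, h]
  by_cases hf : f ∈ s
  · by_cases hg : g ∈ s <;> simp [mulEdge_monomial, hf, hg]
  by_cases hg : g ∈ s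
  · simp [mulEdge_monomial, hf, hg]
  simp only [Module.End.mul_apply, LinearMap.neg_apply, mulEdge_monomial, hf, hg, hfg, hfg.symm,
    Finset.mem_insert, or_self, if_false, map_smul, smul_smul]
  rw [edgeSign_mul_edgeSign_insert hfg.symm hg hf, Finset.insert_comm, neg_smul]

lemma mulEdge_mul_self (f : β) : mulEdge V f * mulEdge V f = 0 := by
  refine monomial_ext fun s M => ?_
  by_cases h : f ∈ s <;> simp [mulEdge_monomial, h]

lemma mulEdge_mul_removeEdge_self (f : β) :
    mulEdge V f * removeEdge V f + removeEdge V f * mulEdge V f = 1 := by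
  refine monomial_ext fun s M => ?_
  by_cases h : f ∈ s <;> simp [mulEdge_monomial, removeEdge_monomial, h, smul_smul]

lemma mulEdge_mul_removeEdge_of_ne {f g : β} (hfg : f ≠ g) :
    mulEdge V f * removeEdge V g + removeEdge V g * mulEdge V f = 0 := by
  refine monomial_ext fun s M => ?_
  by_cases hg : g ∉ s
  · by_cases hf : f ∈ s <;> simp [mulEdge_monomial, removeEdge_monomial, hf, hg, hfg.symm]
  by_cases hf : f ∈ s
  · by_cases hg : g ∈ s <;> simp [mulEdge_monomial, removeEdge_monomial, hf, hg, hfg]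
  rw [not_not] at hg
  simp only [LinearMap.add_apply, LinearMap.zero_apply, Module.End.mul_apply, mulEdge_monomial,
    removeEdge_monomial, hf, hg, Finset.mem_insert, Finset.mem_erase, and_false, or_true, if_true,
    if_false, map_smul, smul_smul]
  obtain ⟨t, hgt, rfl⟩ : ∃ t, g ∉ t ∧ s = insert g t :=
    ⟨s.erase g, by simp, (Finset.insert_erase hg).symm⟩
  have hft : f ∉ t := fun h => hf (Finset.mem_insert_of_mem h)
  rw [Finset.erase_insert hgt, Finset.insert_comm, Finset.erase_insert (by simp [hfg.symm, hgt]),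
    edgeSign_insert_self, edgeSign_insert_self, ← add_smul, mul_comm (edgeSign f _),
    edgeSign_insert_mul_edgeSign_insert hfg.symm hgt hft, mul_comm (edgeSign g t), add_neg_cancel,
    zero_smul]

lemma commute_mulEdge_edgeProj {f : β} {𝒮 : Set (Finset β)} (h : ∀ s, insert f s ∈ 𝒮 ↔ s ∈ 𝒮) :
    Commute (mulEdge V f) (edgeProj V 𝒮) := by
  refine monomial_ext fun s M => ?_
  by_cases hf : f ∈ s <;> by_cases hs : s ∈ 𝒮 <;> simp [edgeProj, mulEdge_monomial, hf, hs, h]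

lemma mulEdge_mem_edgeSpan {𝒮 𝒯 : Set (Finset β)} {f : β} (h : ∀ s ∈ 𝒮, insert f s ∈ 𝒯)
    {z : MonomialCochain V β} (hz : z ∈ edgeSpan V 𝒮) : mulEdge V f z ∈ edgeSpan V 𝒯 := by
  refine map_mem_of_mem_edgeSpan _ (fun s hs M => ?_) hz
  rw [mulEdge_monomial]
  split_ifs
  · exact Submodule.zero_mem _
  · exact Submodule.smul_mem _ _ (monomial_mem_edgeSpan (h s hs) M)

lemma mulEdge_mem_edgeSpan_mem (f : β) (z : MonomialCochain V β) :
    mulEdge V f z ∈ edgeSpan V {s | f ∈ s} := by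
  refine map_mem_of_forall_monomial _ (fun s M => ?_) z
  exact mulEdge_mem_edgeSpan (𝒮 := Set.univ) (by simp) (monomial_mem_edgeSpan (Set.mem_univ s) M)

lemma removeEdge_mem_edgeSpan {𝒮 𝒯 : Set (Finset β)} {f : β} (h : ∀ s ∈ 𝒮, f ∈ s → s.erase f ∈ 𝒯)
    {z : MonomialCochain V β} (hz : z ∈ edgeSpan V 𝒮) : removeEdge V f z ∈ edgeSpan V 𝒯 := by
  refine map_mem_of_mem_edgeSpan _ (fun s hs M => ?_) hz
  rw [removeEdge_monomial]
  split_ifs with hf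
  · exact Submodule.smul_mem _ _ (monomial_mem_edgeSpan (h s hs hf) M)
  · exact Submodule.zero_mem _

variable [DecidableEq V]

lemma commute_mulEdge_mulVar (f : β) (v : V) : Commute (mulEdge V f) (mulVar β v) := by
  refine monomial_ext fun s M => ?_
  by_cases h : f ∈ s <;> by_cases h' : v ∈ M <;> simp [mulEdge_monomial, mulVar_monomial, h, h']

lemma commute_mulEdge_coeffVar (f : β) (v : V) : Commute (mulEdge V f) (coeffVar β v) := by
  refine monomial_ext fun s M => ?_
  by_cases h : f ∈ s <;> by_cases h' : v ∈ M <;> simp [mulEdge_monomial, coeffVar_monomial, h, h']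

lemma commute_removeEdge_mulVar (f : β) (v : V) : Commute (removeEdge V f) (mulVar β v) := by
  refine monomial_ext fun s M => ?_
  by_cases h : f ∈ s <;> by_cases h' : v ∈ M <;>
    simp [removeEdge_monomial, mulVar_monomial, h, h']

end Edges

end Monomials

section Bidegree

variable {V β : Type*}

/-- The span of the monomials `e_s x_M` with `(#s, #M) = d`. -/
def monomialPart (V β : Type*) (d : ℤ × ℤ) : Submodule ℤ (MonomialCochain V β) :=
  monomialSpan {p | ((p.1.card : ℤ), (p.2.card : ℤ)) = d}

/-- The endomorphisms of the monomial cochains that are homogeneous of bidegree `d`. -/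
def homogeneousEnd (V β : Type*) (d : ℤ × ℤ) : Submodule ℤ (Module.End ℤ (MonomialCochain V β)) :=
  ⨅ k, Submodule.compatibleMaps (monomialPart V β k) (monomialPart V β (k + d))

lemma mem_homogeneousEnd {φ : Module.End ℤ (MonomialCochain V β)} {d : ℤ × ℤ} :
    φ ∈ homogeneousEnd V β d ↔ ∀ k, ∀ z ∈ monomialPart V β k, φ z ∈ monomialPart V β (k + d) :=
  Submodule.mem_iInf _

lemma one_mem_homogeneousEnd : 1 ∈ homogeneousEnd V β 0 :=
  mem_homogeneousEnd.2 fun c z hz => by rwa [add_zero]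

lemma mul_mem_homogeneousEnd {φ ψ : Module.End ℤ (MonomialCochain V β)} {d d' d'' : ℤ × ℤ}
    (hφ : φ ∈ homogeneousEnd V β d) (hψ : ψ ∈ homogeneousEnd V β d')
    (h : d + d' = d'' := by decide) : φ * ψ ∈ homogeneousEnd V β d'' :=
  mem_homogeneousEnd.2 fun c z hz => by
    rw [← h, add_comm d, ← add_assoc]
    exact mem_homogeneousEnd.1 hφ _ _ (mem_homogeneousEnd.1 hψ c z hz)

lemma mem_homogeneousEnd_of_monomial {φ : Module.End ℤ (MonomialCochain V β)} {d : ℤ × ℤ}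
    (h : ∀ s M, φ (monomial s M) ∈ monomialPart V β (s.card + d.1, M.card + d.2)) :
    φ ∈ homogeneousEnd V β d := by
  refine mem_homogeneousEnd.2 fun k z hz => map_mem_of_mem_monomialSpan φ ?_ hz
  rintro s M rfl
  exact h s M

lemma monomial_mem_monomialPart {s : Finset β} {M : Finset V} {d : ℤ × ℤ} (hs : (s.card : ℤ) = d.1)
    (hM : (M.card : ℤ) = d.2) : monomial s M ∈ monomialPart V β d :=
  monomial_mem_monomialSpan (Prod.ext hs hM)

lemma edgeProj_mem_homogeneousEnd (𝒮 : Set (Finset β)) : edgeProj V 𝒮 ∈ homogeneousEnd V β 0 := by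
  refine mem_homogeneousEnd_of_monomial fun s M => ?_
  by_cases h : s ∈ 𝒮
  · rw [edgeProj_monomial_of_mem h]
    exact monomial_mem_monomialPart (by simp) (by simp)
  · rw [edgeProj_monomial_of_notMem h]
    exact Submodule.zero_mem _

lemma mulVar_mem_homogeneousEnd [DecidableEq V] (v : V) :
    mulVar β v ∈ homogeneousEnd V β (0, 1) := by
  refine mem_homogeneousEnd_of_monomial fun s M => ?_
  rw [mulVar_monomial]
  split_ifs with h
  · exact Submodule.zero_mem _
  · exact monomial_mem_monomialPart (by simp) (by simp [h])

lemma coeffVar_mem_homogeneousEnd [DecidableEq V] (v : V) :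
    coeffVar β v ∈ homogeneousEnd V β (0, -1) := by
  refine mem_homogeneousEnd_of_monomial fun s M => ?_
  rw [coeffVar_monomial]
  split_ifs with h
  · refine monomial_mem_monomialPart (by simp) ?_
    grind [Finset.card_erase_add_one]
  · exact Submodule.zero_mem _

variable [LinearOrder β]

lemma mulEdge_mem_homogeneousEnd (f : β) : mulEdge V f ∈ homogeneousEnd V β (1, 0) := by
  refine mem_homogeneousEnd_of_monomial fun s M => ?_
  rw [mulEdge_monomial]
  split_ifs with h
  · exact Submodule.zero_mem _
  · exact Submodule.smul_mem _ _ (monomial_mem_monomialPart (by simp [h]) (by simp))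

lemma removeEdge_mem_homogeneousEnd (f : β) : removeEdge V f ∈ homogeneousEnd V β (-1, 0) := by
  refine mem_homogeneousEnd_of_monomial fun s M => ?_
  rw [removeEdge_monomial]
  split_ifs with h
  · refine Submodule.smul_mem _ _ (monomial_mem_monomialPart ?_ (by simp))
    grind [Finset.card_erase_add_one]
  · exact Submodule.zero_mem _

end Bidegree

section Presentation

open scoped Classical

variable {α β : Type*}

/-- The relations that present the chromatic complex of `G` as a quotient of the monomial cochains:
`e_s = 0` unless `s` consists of edges of `G`, and `x_u e_s = x_v e_s` if an edge of `s` joins `u`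
and `v`. -/
def relations (G : Graph α β) : Submodule ℤ (MonomialCochain V(G) β) :=
  edgeSpan V(G) {s | ¬ (s : Set β) ⊆ E(G)} ⊔
    Submodule.span ℤ {z | ∃ (s : Finset β) (M : Finset V(G)), ∃ f ∈ s, ∃ u v : V(G),
      G.IsLink f u v ∧ z = mulVar β u (monomial s M) - mulVar β v (monomial s M)}

/-- The endomorphisms of the monomial cochains that are homogeneous of bidegree `d` and preserve the
relations, so that they induce endomorphisms of `Cochain G`; see `descend`. -/
def chromaticEnd (G : Graph α β) (d : ℤ × ℤ) :
    Submodule ℤ (Module.End ℤ (MonomialCochain V(G) β)) :=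
  Submodule.compatibleMaps (relations G) (relations G) ⊓ homogeneousEnd V(G) β d

variable {G : Graph α β}

lemma one_mem_chromaticEnd : 1 ∈ chromaticEnd G 0 :=
  ⟨fun _ hz => hz, one_mem_homogeneousEnd⟩

lemma mul_mem_chromaticEnd {φ ψ : Module.End ℤ (MonomialCochain V(G) β)} {d d' d'' : ℤ × ℤ}
    (hφ : φ ∈ chromaticEnd G d) (hψ : ψ ∈ chromaticEnd G d') (h : d + d' = d'' := by decide) :
    φ * ψ ∈ chromaticEnd G d'' :=
  ⟨fun _ hz => hφ.1 (hψ.1 hz), mul_mem_homogeneousEnd hφ.2 hψ.2 h⟩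

lemma mem_relations_of_mem_edgeSpan {z : MonomialCochain V(G) β}
    (hz : z ∈ edgeSpan V(G) {s | ¬ (s : Set β) ⊆ E(G)}) : z ∈ relations G :=
  Submodule.mem_sup_left hz

lemma mulVar_sub_mulVar_mem_relations {u v : V(G)} {z : MonomialCochain V(G) β}
    (hz : z ∈ edgeSpan V(G) {s | component G s u = component G s v}) :
    mulVar β u z - mulVar β v z ∈ relations G := by
  refine map_mem_of_mem_edgeSpan (mulVar β u - mulVar β v) (fun s hs M => ?_) hz
  rw [LinearMap.sub_apply]
  replace hs := Quot.eqvGen_exact hs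
  clear hz
  induction hs with
  | rel u v h =>
    obtain ⟨f, hf, h⟩ := h
    exact Submodule.mem_sup_right (Submodule.subset_span ⟨s, M, f, hf, u, v, h, rfl⟩)
  | refl u => simp
  | symm u v h ih =>
    rw [← neg_sub]
    exact Submodule.neg_mem _ ih
  | trans u v w h h' ih ih' =>
    rw [← sub_add_sub_cancel _ (mulVar β v (monomial s M))]
    exact Submodule.add_mem _ ih ih'

lemma relations_le_comap {N : Type*} [AddCommGroup N] {L : Submodule ℤ N}
    (φ : MonomialCochain V(G) β →ₗ[ℤ] N)
    (hE : ∀ s : Finset β, ¬ (s : Set β) ⊆ E(G) → ∀ M, φ (monomial s M) ∈ L)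
    (hx : ∀ s : Finset β, ∀ f ∈ s, ∀ u v : V(G), G.IsLink f u v → ∀ M,
      φ (mulVar β u (monomial s M) - mulVar β v (monomial s M)) ∈ L) :
    relations G ≤ L.comap φ := by
  refine sup_le (fun _ hz => map_mem_of_mem_edgeSpan φ hE hz) (Submodule.span_le.2 ?_)
  rintro _ ⟨s, M, f, hf, u, v, h, rfl⟩
  exact hx s f hf u v h M

lemma map_mulVar_sub_mulVar_mem_relations {φ : Module.End ℤ (MonomialCochain V(G) β)} {u v : V(G)}
    (hu : Commute φ (mulVar β u)) (hv : Commute φ (mulVar β v)) {z : MonomialCochain V(G) β}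
    (hz : φ z ∈ edgeSpan V(G) {s | component G s u = component G s v}) :
    φ (mulVar β u z - mulVar β v z) ∈ relations G := by
  have hcomm {w} (hw : Commute φ (mulVar β w)) : φ (mulVar β w z) = mulVar β w (φ z) :=
    LinearMap.congr_fun hw z
  rw [map_sub, hcomm hu, hcomm hv]
  exact mulVar_sub_mulVar_mem_relations hz

lemma component_eq_of_isLink {s : Finset β} {f : β} {u v : V(G)} (hf : f ∈ s)
    (h : G.IsLink f u v) : component G s u = component G s v :=
  Quot.sound ⟨f, hf, h⟩

lemma mulVar_mem_chromaticEnd (w : V(G)) : mulVar β w ∈ chromaticEnd G (0, 1) := by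
  refine ⟨relations_le_comap _ (fun s hs M => ?_) fun s f hf u v h M => ?_,
    mulVar_mem_homogeneousEnd w⟩
  · exact mem_relations_of_mem_edgeSpan (mulVar_mem_edgeSpan w (monomial_mem_edgeSpan hs M))
  · exact map_mulVar_sub_mulVar_mem_relations (commute_mulVar_mulVar w u)
      (commute_mulVar_mulVar w v)
      (mulVar_mem_edgeSpan w (monomial_mem_edgeSpan (component_eq_of_isLink hf h) M))

/-- A representative of the component of `[G : s]` containing the vertex `v`. -/
def root (G : Graph α β) (s : Finset β) (v : V(G)) : V(G) := Quot.out (component G s v)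

lemma component_root (s : Finset β) (v : V(G)) : component G s (root G s v) = component G s v :=
  Quot.out_eq _

lemma root_eq_root_iff {s : Finset β} {u v : V(G)} :
    root G s u = root G s v ↔ component G s u = component G s v := by
  refine ⟨fun h => ?_, fun h => by rw [root, h, root]⟩
  rw [← component_root, h, component_root]

/-- The normal form of the monomial `e_s x_M` modulo the relations: it vanishes if two elements of
`M` lie in the same component of `[G : s]`, and otherwise every element of `M` is replaced by the
representative of its component. -/
def normalForm (G : Graph α β) (s : Finset β) (M : Finset V(G)) : MonomialCochain V(G) β :=
  if Set.InjOn (component G s) M then monomial s (M.image (root G s)) else 0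

lemma injOn_coe_insert_iff {ι κ : Type*} [DecidableEq ι] (f : ι → κ) {M : Finset ι} {v : ι}
    (hv : v ∉ M) :
    Set.InjOn f (insert v M : Finset ι) ↔ Set.InjOn f M ∧ f v ∉ f '' M := by
  rw [Finset.coe_insert, Set.injOn_insert (Finset.mem_coe.not.2 hv)]

lemma mulVar_root_normalForm {s : Finset β} {M : Finset V(G)} {v : V(G)} (hv : v ∉ M) :
    mulVar β (root G s v) (normalForm G s M) = normalForm G s (insert v M) := by
  have hroot : root G s v ∈ M.image (root G s) ↔ component G s v ∈ component G s '' M := by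
    simp [root_eq_root_iff]
  simp only [normalForm, injOn_coe_insert_iff _ hv, Finset.image_insert]
  by_cases hM : Set.InjOn (component G s) M
  · simp only [hM, true_and, if_true, mulVar_monomial, hroot, ite_not]
  · simp only [hM, false_and, if_false, map_zero]

lemma monomial_sub_normalForm_mem_relations (s : Finset β) (M : Finset V(G)) :
    monomial s M - normalForm G s M ∈ relations G := by
  induction M using Finset.induction_on with
  | empty => simp [normalForm]
  | insert v M hv ih =>
    have hmul : mulVar β v (monomial s M) = monomial s (insert v M) := by
      rw [mulVar_monomial, if_neg hv]
    have hnf : normalForm G s M ∈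
        edgeSpan V(G) {t | component G t v = component G t (root G s v)} := by
      unfold normalForm
      split_ifs
      · exact monomial_mem_edgeSpan (component_root s v).symm _
      · exact Submodule.zero_mem _
    rw [← hmul, ← mulVar_root_normalForm hv,
      ← sub_add_sub_cancel _ (mulVar β v (normalForm G s M)), ← map_sub]
    exact Submodule.add_mem _ ((mulVar_mem_chromaticEnd v).1 ih)
      (mulVar_sub_mulVar_mem_relations hnf)

/-- The enhanced state with edges `s` in which the components meeting `M` are coloured `x`. -/
def markedState (G : Graph α β) (s : Finset β) (hs : (s : Set β) ⊆ E(G)) (M : Finset V(G)) :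
    EnhancedState G where
  edges := s
  edges_subset := hs
  colour v := if ∃ w ∈ M, component G s w = component G s v then Colour.x else Colour.one
  colour_eq u v h := by rw [show component G s u = component G s v from Quot.sound h]

lemma markedState_colour_eq_x {s : Finset β} (hs : (s : Set β) ⊆ E(G)) (M : Finset V(G))
    (v : V(G)) : (markedState G s hs M).colour v = Colour.x ↔
      ∃ w ∈ M, component G s w = component G s v :=
  ⟨fun h => by_contra fun h' => Colour.noConfusion ((if_neg h').symm.trans h), fun h => if_pos h⟩

lemma EnhancedState.ext_of_colour_eq_x {S T : EnhancedState G} (hedges : S.edges = T.edges)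
    (hcolour : ∀ v, S.colour v = Colour.x ↔ T.colour v = Colour.x) : S = T := by
  refine EnhancedState.ext hedges (funext fun v => ?_)
  have := hcolour v
  cases hS : S.colour v <;> cases hT : T.colour v <;> simp_all

lemma markedState_congr {s : Finset β} (hs : (s : Set β) ⊆ E(G)) {M M' : Finset V(G)}
    (h : component G s '' M = component G s '' M') :
    markedState G s hs M = markedState G s hs M' := by
  refine EnhancedState.ext_of_colour_eq_x rfl fun v => ?_
  rw [markedState_colour_eq_x, markedState_colour_eq_x]
  simpa using Set.ext_iff.1 h (component G s v)

lemma xCount_markedState {s : Finset β} (hs : (s : Set β) ⊆ E(G)) {M : Finset V(G)}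
    (hM : Set.InjOn (component G s) M) : (markedState G s hs M).xCount = M.card := by
  have hx : {K | (markedState G s hs M).componentColour K = Colour.x} = component G s '' M := by
    ext ⟨v⟩
    exact markedState_colour_eq_x hs M v
  calc (markedState G s hs M).xCount = (component G s '' M).ncard := congrArg Set.ncard hx
    _ = M.card := by rw [hM.ncard_image, Set.ncard_coe_finset]

/-- The cochain that a monomial represents: `e_s x_M` stands for the enhanced state
`markedState G s _ M`, and for `0` if `s` contains a non-edge or two elements of `M` lie in the
same component of `[G : s]`. -/
def toCochain (G : Graph α β) : MonomialCochain V(G) β →ₗ[ℤ] Cochain G :=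
  monomialLift fun s M =>
    if h : (s : Set β) ⊆ E(G) ∧ Set.InjOn (component G s) M then
      Finsupp.single (markedState G s h.1 M) 1 else 0

lemma toCochain_monomial_of_injOn {s : Finset β} {M : Finset V(G)} (hs : (s : Set β) ⊆ E(G))
    (hM : Set.InjOn (component G s) M) :
    toCochain G (monomial s M) = Finsupp.single (markedState G s hs M) 1 := by
  rw [toCochain, monomialLift_monomial, dif_pos ⟨hs, hM⟩]

lemma toCochain_monomial_of_not {s : Finset β} {M : Finset V(G)}
    (h : ¬ ((s : Set β) ⊆ E(G) ∧ Set.InjOn (component G s) M)) :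
    toCochain G (monomial s M) = 0 := by
  rw [toCochain, monomialLift_monomial, dif_neg h]

lemma toCochain_mulVar_monomial {s : Finset β} (hs : (s : Set β) ⊆ E(G)) (M : Finset V(G))
    (u : V(G)) : toCochain G (mulVar β u (monomial s M)) =
      if Set.InjOn (component G s) M ∧ component G s u ∉ component G s '' M then
        Finsupp.single (markedState G s hs (insert u M)) 1 else 0 := by
  rw [mulVar_monomial]
  by_cases hu : u ∈ M
  · rw [if_pos hu, if_neg fun h => h.2 ⟨u, hu, rfl⟩, map_zero]
  rw [if_neg hu]
  split_ifs with h <;> rw [← injOn_coe_insert_iff _ hu] at h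
  · exact toCochain_monomial_of_injOn hs h
  · exact toCochain_monomial_of_not fun h' => h h'.2

lemma relations_le_ker_toCochain : relations G ≤ LinearMap.ker (toCochain G) := by
  have hE : ∀ s : Finset β, ¬ (s : Set β) ⊆ E(G) → ∀ M,
      toCochain G (monomial s M) ∈ (⊥ : Submodule ℤ (Cochain G)) :=
    fun s hs M => toCochain_monomial_of_not fun h => hs h.1
  refine relations_le_comap _ hE fun s f hf u v h M => ?_
  rw [map_sub]
  by_cases hs : (s : Set β) ⊆ E(G)
  · have huv := component_eq_of_isLink hf h
    rw [toCochain_mulVar_monomial hs, toCochain_mulVar_monomial hs, huv,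
      markedState_congr hs (M := insert u M) (M' := insert v M)
        (by simp only [Finset.coe_insert, Set.image_insert_eq, huv]),
      sub_self]
    exact Submodule.zero_mem _
  · have hmem (w : V(G)) :
        mulVar β w (monomial s M) ∈ edgeSpan V(G) {s : Finset β | ¬ (s : Set β) ⊆ E(G)} :=
      mulVar_mem_edgeSpan w (monomial_mem_edgeSpan hs M)
    exact Submodule.sub_mem _ (map_mem_of_mem_edgeSpan _ hE (hmem u))
      (map_mem_of_mem_edgeSpan _ hE (hmem v))

variable [Finite V(G)]

/-- The representatives of the components coloured `x`. -/
def EnhancedState.marks (S : EnhancedState G) : Finset V(G) :=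
  (Set.toFinite {v | S.colour v = Colour.x ∧ root G S.edges v = v}).toFinset

lemma EnhancedState.mem_marks {S : EnhancedState G} {v : V(G)} :
    v ∈ S.marks ↔ S.colour v = Colour.x ∧ root G S.edges v = v := by
  simp [EnhancedState.marks]

lemma EnhancedState.injOn_component_marks (S : EnhancedState G) :
    Set.InjOn (component G S.edges) S.marks := by
  intro u hu v hv h
  rw [← (EnhancedState.mem_marks.1 hu).2, ← (EnhancedState.mem_marks.1 hv).2]
  exact root_eq_root_iff.2 h

lemma EnhancedState.markedState_marks (S : EnhancedState G) :
    markedState G S.edges S.edges_subset S.marks = S := by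
  refine EnhancedState.ext_of_colour_eq_x rfl fun v => ?_
  rw [markedState_colour_eq_x]
  constructor
  · rintro ⟨w, hw, h⟩
    rw [← S.colour_eq_of_component_eq h]
    exact (EnhancedState.mem_marks.1 hw).1
  · intro h
    refine ⟨root G S.edges v, EnhancedState.mem_marks.2 ⟨?_, ?_⟩, component_root _ _⟩
    · rw [S.colour_eq_of_component_eq (component_root _ _), h]
    · rw [root_eq_root_iff, component_root]

lemma EnhancedState.card_marks (S : EnhancedState G) : S.marks.card = S.xCount := by
  conv_rhs => rw [← S.markedState_marks]
  exact (xCount_markedState _ S.injOn_component_marks).symm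

lemma marks_markedState {s : Finset β} (hs : (s : Set β) ⊆ E(G)) (M : Finset V(G)) :
    (markedState G s hs M).marks = M.image (root G s) := by
  ext v
  rw [EnhancedState.mem_marks, markedState_colour_eq_x, Finset.mem_image]
  constructor
  · rintro ⟨⟨w, hw, h⟩, hv⟩
    exact ⟨w, hw, (root_eq_root_iff.2 h).trans hv⟩
  · rintro ⟨w, hw, rfl⟩
    exact ⟨⟨w, hw, (component_root _ _).symm⟩, root_eq_root_iff.2 (component_root _ _)⟩

/-- The linear section of `toCochain` that represents every enhanced state by a monomial. -/
def toMonomial (G : Graph α β) [Finite V(G)] : Cochain G →ₗ[ℤ] MonomialCochain V(G) β :=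
  Finsupp.linearCombination ℤ fun S => monomial S.edges S.marks

lemma toMonomial_single (S : EnhancedState G) :
    toMonomial G (Finsupp.single S 1) = monomial S.edges S.marks := by
  simp [toMonomial]

lemma toCochain_toMonomial (z : Cochain G) : toCochain G (toMonomial G z) = z := by
  suffices h : toCochain G ∘ₗ toMonomial G = LinearMap.id from LinearMap.congr_fun h z
  refine Finsupp.lhom_ext' fun S => LinearMap.ext_ring ?_
  simp only [LinearMap.comp_apply, Finsupp.lsingle_apply, toMonomial_single]
  rw [toCochain_monomial_of_injOn S.edges_subset S.injOn_component_marks, S.markedState_marks,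
    LinearMap.id_apply]

lemma sub_toMonomial_toCochain_mem_relations (z : MonomialCochain V(G) β) :
    z - toMonomial G (toCochain G z) ∈ relations G := by
  refine map_mem_of_forall_monomial (LinearMap.id - toMonomial G ∘ₗ toCochain G) (fun s M => ?_) z
  simp only [LinearMap.sub_apply, LinearMap.comp_apply, LinearMap.id_apply]
  by_cases hs : (s : Set β) ⊆ E(G)
  · have hnf := monomial_sub_normalForm_mem_relations s M
    unfold normalForm at hnf
    split_ifs at hnf with hM
    · rwa [toCochain_monomial_of_injOn hs hM, toMonomial_single, marks_markedState]
    · rwa [toCochain_monomial_of_not fun h => hM h.2, map_zero]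
  · rw [toCochain_monomial_of_not fun h => hs h.1, map_zero, sub_zero]
    exact mem_relations_of_mem_edgeSpan (monomial_mem_edgeSpan hs M)

/-- The endomorphism of `Cochain G` induced by an endomorphism of the monomial cochains that
preserves the relations. -/
def descend (φ : Module.End ℤ (MonomialCochain V(G) β)) : Cochain G →ₗ[ℤ] Cochain G :=
  toCochain G ∘ₗ φ ∘ₗ toMonomial G

lemma descend_toCochain {φ : Module.End ℤ (MonomialCochain V(G) β)} {d : ℤ × ℤ}
    (hφ : φ ∈ chromaticEnd G d) (z : MonomialCochain V(G) β) :
    descend φ (toCochain G z) = toCochain G (φ z) := by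
  have := relations_le_ker_toCochain (hφ.1 (sub_toMonomial_toCochain_mem_relations z))
  rw [LinearMap.mem_ker, map_sub, map_sub, sub_eq_zero] at this
  exact this.symm

end Presentation

section MonomialDifferential

open scoped Classical

variable {α β : Type*} [LinearOrder β] {G : Graph α β}

lemma mulEdge_mem_chromaticEnd (f : β) : mulEdge V(G) f ∈ chromaticEnd G (1, 0) := by
  refine ⟨relations_le_comap _ (fun s hs M => ?_) fun s g hg u v h M => ?_,
    mulEdge_mem_homogeneousEnd f⟩
  · refine mem_relations_of_mem_edgeSpan (mulEdge_mem_edgeSpan ?_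
      (monomial_mem_edgeSpan (𝒮 := {t : Finset β | ¬ (t : Set β) ⊆ E(G)}) hs M))
    exact fun t ht h => ht ((Finset.coe_subset.2 (Finset.subset_insert f t)).trans h)
  · refine map_mulVar_sub_mulVar_mem_relations (commute_mulEdge_mulVar f u)
      (commute_mulEdge_mulVar f v)
      (mulEdge_mem_edgeSpan (fun t ht => ?_) (monomial_mem_edgeSpan (𝒮 := {t | g ∈ t}) hg M))
    exact component_eq_of_isLink (Finset.mem_insert_of_mem ht) h

lemma vanishes_markedState_iff {s : Finset β} (hs : (s : Set β) ⊆ E(G)) {M : Finset V(G)}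
    (hM : Set.InjOn (component G s) M) (f : β) :
    (markedState G s hs M).Vanishes f ↔ ¬ Set.InjOn (component G (insert f s)) M := by
  have hmono {u v : V(G)} (h : component G s u = component G s v) :
      component G (insert f s) u = component G (insert f s) v :=
    EnhancedState.component_eq_of_subset (Finset.subset_insert f s) h
  constructor
  · rintro ⟨u, v, hu, hv, heq, hne⟩ hinj
    obtain ⟨u', hu', hu⟩ := (markedState_colour_eq_x hs M u).1 hu
    obtain ⟨v', hv', hv⟩ := (markedState_colour_eq_x hs M v).1 hv
    obtain rfl := hinj hu' hv' ((hmono hu).trans (heq.trans (hmono hv).symm))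
    exact hne (hu.symm.trans hv)
  · intro h
    simp only [Set.InjOn, not_forall] at h
    obtain ⟨u, hu, v, hv, heq, hne⟩ := h
    exact ⟨u, v, (markedState_colour_eq_x hs M u).2 ⟨u, hu, rfl⟩,
      (markedState_colour_eq_x hs M v).2 ⟨v, hv, rfl⟩, heq, fun h => hne (hM hu hv h)⟩

lemma addEdge_markedState {s : Finset β} (hs : (s : Set β) ⊆ E(G)) (M : Finset V(G)) (f : E(G))
    (hfs : ((insert (f : β) s : Finset β) : Set β) ⊆ E(G)) :
    (markedState G s hs M).addEdge f = markedState G (insert (f : β) s) hfs M := by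
  refine EnhancedState.ext_of_colour_eq_x rfl fun v => ?_
  rw [EnhancedState.addEdge_colour_eq_x, markedState_colour_eq_x]
  constructor
  · rintro ⟨u, huv, hu⟩
    obtain ⟨w, hw, hwu⟩ := (markedState_colour_eq_x hs M u).1 hu
    exact ⟨w, hw, (EnhancedState.component_eq_of_subset (Finset.subset_insert _ s) hwu).trans huv⟩
  · rintro ⟨w, hw, hwv⟩
    exact ⟨w, hwv, (markedState_colour_eq_x hs M w).2 ⟨w, hw, rfl⟩⟩

lemma addEdgeCochain_markedState {s : Finset β} (hs : (s : Set β) ⊆ E(G)) {M : Finset V(G)}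
    (hM : Set.InjOn (component G s) M) (f : E(G)) :
    addEdgeCochain (markedState G s hs M) f = toCochain G (monomial (insert (f : β) s) M) := by
  have hfs : ((insert (f : β) s : Finset β) : Set β) ⊆ E(G) := by
    rw [Finset.coe_insert]
    exact Set.insert_subset f.2 hs
  unfold addEdgeCochain
  split_ifs with hv <;> rw [vanishes_markedState_iff hs hM] at hv
  · rw [toCochain_monomial_of_not fun h => hv h.2]
  · rw [toCochain_monomial_of_injOn hfs (not_not.1 hv), addEdge_markedState hs M f hfs]

lemma toCochain_mulEdge_monomial_of_not {s : Finset β} {M : Finset V(G)}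
    (h : ¬ ((s : Set β) ⊆ E(G) ∧ Set.InjOn (component G s) M)) (f : β) :
    toCochain G (mulEdge V(G) f (monomial s M)) = 0 := by
  have hsub := Finset.subset_insert f s
  rw [mulEdge_monomial]
  split_ifs
  · exact map_zero _
  rw [map_smul, toCochain_monomial_of_not, smul_zero]
  rintro ⟨hE, hinj⟩
  exact h ⟨(Finset.coe_subset.2 hsub).trans hE, fun u hu v hv huv =>
    hinj hu hv (EnhancedState.component_eq_of_subset hsub huv)⟩

variable [Fintype β]

/-- The differential on the monomial cochains: multiplication by the sum of the `e_f` over all edges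
`f` of `G`. -/
def monomialDifferential (G : Graph α β) : Module.End ℤ (MonomialCochain V(G) β) :=
  ∑ f with f ∈ E(G), mulEdge V(G) f

lemma monomialDifferential_mul_self : monomialDifferential G * monomialDifferential G = 0 := by
  rw [monomialDifferential, Finset.sum_mul_sum, ← Finset.sum_product']
  refine Finset.sum_involution (fun p _ => p.swap) ?_ ?_ ?_ fun _ _ => Prod.swap_swap _
  · rintro ⟨f, g⟩ -
    exact add_eq_zero_iff_eq_neg.2 (mulEdge_mul_mulEdge f g)
  · rintro ⟨f, g⟩ - hne heq
    obtain rfl : g = f := congrArg Prod.fst heq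
    exact hne (mulEdge_mul_self g)
  · rintro ⟨f, g⟩ h
    simpa [and_comm] using h

lemma monomialDifferential_mem_chromaticEnd : monomialDifferential G ∈ chromaticEnd G (1, 0) :=
  Submodule.sum_mem _ fun f _ => mulEdge_mem_chromaticEnd f

lemma commute_monomialDifferential_mulVar (v : V(G)) :
    Commute (monomialDifferential G) (mulVar β v) :=
  Commute.sum_left _ _ _ fun f _ => commute_mulEdge_mulVar f v

lemma monomialDifferential_mul_removeEdge {f : β} (hf : f ∈ E(G)) :
    monomialDifferential G * removeEdge V(G) f + removeEdge V(G) f * monomialDifferential G =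
      1 := by
  rw [monomialDifferential, Finset.sum_mul, Finset.mul_sum, ← Finset.sum_add_distrib,
    Finset.sum_eq_single f (fun g _ hgf => mulEdge_mul_removeEdge_of_ne hgf) (by simp [hf])]
  exact mulEdge_mul_removeEdge_self f

lemma monomialDifferential_mem_edgeSpan {𝒮 : Set (Finset β)} (h : ∀ f, ∀ s ∈ 𝒮, insert f s ∈ 𝒮)
    {z : MonomialCochain V(G) β} (hz : z ∈ edgeSpan V(G) 𝒮) :
    monomialDifferential G z ∈ edgeSpan V(G) 𝒮 := by
  rw [monomialDifferential, LinearMap.sum_apply]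
  exact Submodule.sum_mem _ fun f _ => mulEdge_mem_edgeSpan (h f) hz

lemma differential_toCochain (z : MonomialCochain V(G) β) :
    differential G (toCochain G z) = toCochain G (monomialDifferential G z) := by
  suffices h : differential G ∘ₗ toCochain G = toCochain G ∘ₗ monomialDifferential G from
    LinearMap.congr_fun h z
  refine monomial_ext fun s M => ?_
  simp only [LinearMap.comp_apply, monomialDifferential, LinearMap.sum_apply, map_sum]
  by_cases h : (s : Set β) ⊆ E(G) ∧ Set.InjOn (component G s) M
  · rw [toCochain_monomial_of_injOn h.1 h.2, differential_single, stateDifferential,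
      Finset.sum_filter]
    refine Finset.sum_congr rfl fun f _ => ?_
    have hedges : (markedState G s h.1 M).edges = s := rfl
    by_cases hfE : f ∈ E(G) <;> by_cases hfs : f ∈ s <;>
      simp [hedges, hfE, hfs, mulEdge_monomial, addEdgeCochain_markedState h.1 h.2, edgeSign]
  · rw [toCochain_monomial_of_not h, map_zero]
    exact (Finset.sum_eq_zero fun f _ => toCochain_mulEdge_monomial_of_not h f).symm

end MonomialDifferential

section Homotopies

section

variable {V β : Type*} [DecidableEq V] [LinearOrder β]

/-- The comultiplication `1 ↦ x ⊗ 1 + 1 ⊗ x`, `x ↦ x ⊗ x` of `ℤ[x]/(x²)` along the edge `f` with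
ends `u` and `v`: remove `f` and multiply by `x_u + x_v`. -/
def comulEdge (f : β) (u v : V) : Module.End ℤ (MonomialCochain V β) :=
  (mulVar β u + mulVar β v) * removeEdge V f

lemma comulEdge_mem_homogeneousEnd (f : β) (u v : V) :
    comulEdge f u v ∈ homogeneousEnd V β (-1, 1) :=
  mul_mem_homogeneousEnd (Submodule.add_mem _ (mulVar_mem_homogeneousEnd u)
    (mulVar_mem_homogeneousEnd v)) (removeEdge_mem_homogeneousEnd f)

lemma comulEdge_mul_mulVar_sub_mulVar (f : β) (u v : V) :
    comulEdge f u v * (mulVar β u - mulVar β v) = 0 := by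
  have hcomm := ((commute_removeEdge_mulVar f u).sub_right (commute_removeEdge_mulVar f v)).eq
  rw [comulEdge, mul_assoc, hcomm, ← mul_assoc, add_mul, mul_sub, mul_sub, mulVar_mul_self,
    mulVar_mul_self, (commute_mulVar_mulVar u v).eq, zero_sub, sub_zero, neg_add_cancel, zero_mul]

end

section

open scoped Classical

variable {α β : Type*} [LinearOrder β] {G : Graph α β}

lemma removeEdge_mem_edgeSpan_not_subset {V : Type*} {f : β} (hf : f ∈ E(G))
    {z : MonomialCochain V β} (hz : z ∈ edgeSpan V {s | ¬ (s : Set β) ⊆ E(G)}) :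
    removeEdge V f z ∈ edgeSpan V {s : Finset β | ¬ (s : Set β) ⊆ E(G)} := by
  refine removeEdge_mem_edgeSpan ?_ hz
  intro s hs hfs h
  refine hs ?_
  rw [← Finset.insert_erase hfs, Finset.coe_insert]
  exact Set.insert_subset hf h

lemma comulEdge_mem_chromaticEnd {f : β} {u v : V(G)} (hf : G.IsLink f u v) :
    comulEdge f u v ∈ chromaticEnd G (-1, 1) := by
  have hmul {z} (hz : z ∈ relations G) : (mulVar β u + mulVar β v) z ∈ relations G :=
    Submodule.add_mem _ ((mulVar_mem_chromaticEnd u).1 hz) ((mulVar_mem_chromaticEnd v).1 hz)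
  refine ⟨relations_le_comap _ (fun s hs M => ?_) fun s g hg p q hpq M => ?_,
    comulEdge_mem_homogeneousEnd f u v⟩
  · exact hmul (mem_relations_of_mem_edgeSpan
      (removeEdge_mem_edgeSpan_not_subset hf.edge_mem (monomial_mem_edgeSpan hs M)))
  · have hself : comulEdge f u v (mulVar β u (monomial s M) - mulVar β v (monomial s M)) = 0 :=
      LinearMap.congr_fun (comulEdge_mul_mulVar_sub_mulVar f u v) (monomial s M)
    rcases eq_or_ne g f with rfl | hgf
    · rcases hf.eq_and_eq_or_eq_and_eq hpq with ⟨hup, hvq⟩ | ⟨huq, hvp⟩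
      · rw [← Subtype.ext hup, ← Subtype.ext hvq, hself]
        exact Submodule.zero_mem _
      · rw [← Subtype.ext huq, ← Subtype.ext hvp, ← neg_sub, map_neg, hself, neg_zero]
        exact Submodule.zero_mem _
    · refine hmul (map_mulVar_sub_mulVar_mem_relations (commute_removeEdge_mulVar f p)
        (commute_removeEdge_mulVar f q) (removeEdge_mem_edgeSpan (𝒮 := {t | g ∈ t})
          (fun t hgt _ => ?_) (monomial_mem_edgeSpan hg M)))
      exact component_eq_of_isLink (Finset.mem_erase_of_ne_of_mem hgf hgt) hpq

lemma component_erase_eq_of_triangle {e f g : β} {a b t : V(G)} (he : G.IsLink e a b)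
    (hf : G.IsLink f t b) (hg : G.IsLink g t a) (hge : g ≠ e) (hgf : g ≠ f) {s : Finset β}
    (hes : e ∈ s) (hfs : f ∈ s) {h : β} (hs : h ∈ s) {u v : V(G)} (huv : G.IsLink h u v) :
    component G (s.erase g) u = component G (s.erase g) v := by
  rcases eq_or_ne h g with rfl | hhg
  · have htb := component_eq_of_isLink (Finset.mem_erase_of_ne_of_mem hgf.symm hfs) hf
    have hab := component_eq_of_isLink (Finset.mem_erase_of_ne_of_mem hge.symm hes) he
    rcases hg.eq_and_eq_or_eq_and_eq huv with ⟨htu, hav⟩ | ⟨htv, hau⟩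
    · rw [← Subtype.ext htu, ← Subtype.ext hav, htb, hab]
    · rw [← Subtype.ext htv, ← Subtype.ext hau, htb, hab]
  · exact component_eq_of_isLink (Finset.mem_erase_of_ne_of_mem hhg hs) huv

/-- The ends of `g` stay connected through `f` and `e`, so removing `g` does not change the
components. -/
lemma removeEdge_mul_edgeProj_mem_chromaticEnd {e f g : β} {a b t : V(G)} (he : G.IsLink e a b)
    (hf : G.IsLink f t b) (hg : G.IsLink g t a) (hge : g ≠ e) (hgf : g ≠ f) :
    removeEdge V(G) g * edgeProj V(G) {s | e ∈ s ∧ f ∈ s} ∈ chromaticEnd G (-1, 0) := by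
  refine ⟨relations_le_comap _ (fun s hs M => ?_) fun s h hh u v huv M => ?_,
    mul_mem_homogeneousEnd (removeEdge_mem_homogeneousEnd g) (edgeProj_mem_homogeneousEnd _)⟩
  · exact mem_relations_of_mem_edgeSpan (removeEdge_mem_edgeSpan_not_subset hg.edge_mem
      (edgeProj_mem_edgeSpan_of_mem _ (monomial_mem_edgeSpan hs M)))
  · have hcomm (w : V(G)) :=
      (commute_removeEdge_mulVar g w).mul_left (commute_edgeProj_mulVar {s | e ∈ s ∧ f ∈ s} w)
    refine map_mulVar_sub_mulVar_mem_relations (hcomm u) (hcomm v) ?_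
    rw [Module.End.mul_apply]
    by_cases hs : e ∈ s ∧ f ∈ s
    · rw [edgeProj_monomial_of_mem (by exact hs)]
      refine removeEdge_mem_edgeSpan (𝒮 := {s}) ?_ (monomial_mem_edgeSpan (Set.mem_singleton s) M)
      rintro _ rfl -
      exact component_erase_eq_of_triangle he hf hg hge hgf hs.1 hs.2 hh huv
    · rw [edgeProj_monomial_of_notMem (by exact hs), map_zero]
      exact Submodule.zero_mem _

end

end Homotopies

section Contractions

/-- `κ` contracts the subspace `L` of the complex with differential `d`: `dκ + κd` is the identity
on `L`. Neither `d` nor `κ` is required to preserve `L`. -/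
def Contracts {R M : Type*} [Ring R] [AddCommGroup M] [Module R M] (d κ : Module.End R M)
    (L : Submodule R M) : Prop :=
  ∀ z ∈ L, (d * κ + κ * d) z = z

lemma Contracts.extend {R M : Type*} [Ring R] [AddCommGroup M] [Module R M]
    {d κ κ' : Module.End R M} {L L' : Submodule R M} (hd : d * d = 0) (hκ : Contracts d κ L)
    (hκ' : ∀ z ∈ L', (1 - (d * κ' + κ' * d)) z ∈ L) :
    Contracts d (κ' + κ * (1 - (d * κ' + κ' * d))) L' := by
  intro z hz
  have hcomm : (1 - (d * κ' + κ' * d)) * d = d * (1 - (d * κ' + κ' * d)) := by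
    simp only [sub_mul, mul_sub, add_mul, mul_add, one_mul, mul_one, mul_assoc, hd, mul_zero,
      ← mul_assoc d d, zero_mul, add_zero, zero_add]
  have hsum : d * (κ' + κ * (1 - (d * κ' + κ' * d))) + (κ' + κ * (1 - (d * κ' + κ' * d))) * d =
      (d * κ' + κ' * d) + (d * κ + κ * d) * (1 - (d * κ' + κ' * d)) := by
    rw [mul_add, add_mul, mul_assoc κ, hcomm, add_mul, mul_assoc, mul_assoc, add_add_add_comm]
  rw [hsum, LinearMap.add_apply, Module.End.mul_apply, hκ _ (hκ' z hz), LinearMap.sub_apply,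
    Module.End.one_apply, add_sub_cancel]

open scoped Classical

variable {α β : Type*} [LinearOrder β] [Fintype β] {G : Graph α β}

lemma monomialDifferential_mul_comulEdge {f : β} (hf : f ∈ E(G)) (u v : V(G)) :
    monomialDifferential G * comulEdge f u v + comulEdge f u v * monomialDifferential G =
      mulVar β u + mulVar β v := by
  have hcomm := ((commute_monomialDifferential_mulVar (G := G) u).add_right
    (commute_monomialDifferential_mulVar v)).eq
  rw [comulEdge, ← mul_assoc, hcomm, mul_assoc, mul_assoc, ← mul_add,
    monomialDifferential_mul_removeEdge hf, mul_one]

lemma contracts_removeEdge_mul_edgeProj {e f g : β} (hg : g ∈ E(G)) :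
    Contracts (monomialDifferential G) (removeEdge V(G) g * edgeProj V(G) {s | e ∈ s ∧ f ∈ s})
      (edgeSpan V(G) {s | e ∈ s ∧ f ∈ s}) := by
  intro z hz
  have hDz := monomialDifferential_mem_edgeSpan (G := G) (𝒮 := {s | e ∈ s ∧ f ∈ s})
    (fun _ _ hs => ⟨Finset.mem_insert_of_mem hs.1, Finset.mem_insert_of_mem hs.2⟩) hz
  rw [LinearMap.add_apply]
  simp only [Module.End.mul_apply, edgeProj_eq_self hz, edgeProj_eq_self hDz]
  exact LinearMap.congr_fun (monomialDifferential_mul_removeEdge hg) z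

lemma sub_homotopy_removeEdge_mem_edgeSpan {e f g : β} (hg : g ∈ E(G)) (hge : g ≠ e)
    {F : Finset β} (hgF : g ∉ F) {z : MonomialCochain V(G) β}
    (hz : z ∈ edgeSpan V(G) {s | e ∈ s ∧ ∃ f' ∈ insert f F, f' ∈ s}) :
    (1 - (monomialDifferential G * (removeEdge V(G) g * edgeProj V(G) {s | e ∈ s ∧ f ∈ s}) +
      removeEdge V(G) g * edgeProj V(G) {s | e ∈ s ∧ f ∈ s} * monomialDifferential G)) z ∈
      edgeSpan V(G) {s | e ∈ s ∧ ∃ f' ∈ F, f' ∈ s} := by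
  refine map_mem_of_mem_edgeSpan _ (fun s hs M => ?_) hz
  rw [LinearMap.sub_apply, Module.End.one_apply]
  by_cases hfs : f ∈ s
  · rw [contracts_removeEdge_mul_edgeProj hg _ (monomial_mem_edgeSpan (by exact ⟨hs.1, hfs⟩) M),
      sub_self]
    exact Submodule.zero_mem _
  · have hsF : ∃ f' ∈ F, f' ∈ s := by
      obtain ⟨-, f', hf', hf's⟩ := hs
      exact ⟨f', Finset.mem_of_mem_insert_of_ne hf' (by rintro rfl; exact hfs hf's), hf's⟩
    have hmem := monomial_mem_edgeSpan (𝒮 := {s | e ∈ s ∧ ∃ f' ∈ F, f' ∈ s}) ⟨hs.1, hsF⟩ M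
    rw [LinearMap.add_apply, Module.End.mul_apply, Module.End.mul_apply,
      edgeProj_monomial_of_notMem (fun h => hfs h.2), map_zero, map_zero, zero_add]
    refine Submodule.sub_mem _ hmem (removeEdge_mem_edgeSpan ?_ (edgeProj_mem_edgeSpan_of_mem _
      (monomialDifferential_mem_edgeSpan ?_ hmem)))
    · rintro t ⟨het, f', hf', hf't⟩ -
      have hf'g : f' ≠ g := fun h => hgF (h ▸ hf')
      exact ⟨Finset.mem_erase_of_ne_of_mem hge.symm het, f', hf',
        Finset.mem_erase_of_ne_of_mem hf'g hf't⟩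
    · rintro h t ⟨het, f', hf', hf't⟩
      exact ⟨Finset.mem_insert_of_mem het, f', hf', Finset.mem_insert_of_mem hf't⟩

lemma exists_contracts_edgeSpan {e : β} {a b : V(G)} (he : G.IsLink e a b) (F : Finset β)
    (hF : ∀ f ∈ F, ∃ (t : V(G)) (g : β), G.IsLink f t b ∧ G.IsLink g t a ∧ g ≠ e ∧ g ∉ F) :
    ∃ κ ∈ chromaticEnd G (-1, 0), (∀ z, κ z ∈ edgeSpan V(G) {s | e ∈ s}) ∧
      Contracts (monomialDifferential G) κ (edgeSpan V(G) {s | e ∈ s ∧ ∃ f ∈ F, f ∈ s}) := by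
  induction F using Finset.induction_on with
  | empty =>
    refine ⟨0, Submodule.zero_mem _, fun _ => Submodule.zero_mem _, fun z hz => ?_⟩
    have h0 := eq_of_mem_edgeSpan (φ := LinearMap.id) (ψ := 0) (fun s h => by simp at h) hz
    simpa using h0.symm
  | insert f F _ ih =>
    obtain ⟨κ, hκ, hκe, hκF⟩ := ih fun f' hf' =>
      let ⟨t, g, hft, hgt, hge, hgF⟩ := hF f' (Finset.mem_insert_of_mem hf')
      ⟨t, g, hft, hgt, hge, fun h => hgF (Finset.mem_insert_of_mem h)⟩
    obtain ⟨t, g, hft, hgt, hge, hgF⟩ := hF f (Finset.mem_insert_self f F)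
    obtain ⟨hgf, hgF⟩ := not_or.1 (Finset.mem_insert.not.1 hgF)
    have hκ' := removeEdge_mul_edgeProj_mem_chromaticEnd he hft hgt hge hgf
    have hD := monomialDifferential_mem_chromaticEnd (G := G)
    refine ⟨_, Submodule.add_mem _ hκ' (mul_mem_chromaticEnd hκ (Submodule.sub_mem _
        one_mem_chromaticEnd (Submodule.add_mem _ (mul_mem_chromaticEnd hD hκ')
          (mul_mem_chromaticEnd hκ' hD)))), fun z => Submodule.add_mem _ ?_ (hκe _),
      hκF.extend monomialDifferential_mul_self fun z =>
        sub_homotopy_removeEdge_mem_edgeSpan hgt.edge_mem hge hgF⟩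
    refine removeEdge_mem_edgeSpan ?_ (edgeProj_mem_edgeSpan _ z)
    exact fun s hs _ => Finset.mem_erase_of_ne_of_mem hge.symm hs.1

end Contractions

section Merge

open scoped Classical

variable {α β : Type*} [LinearOrder β] {G : Graph α β} {e : β} {a b : V(G)}

/-- The merge map: on the monomials in which the vertex `b` is isolated, take the coefficient of
`x_b` and add the edge `e`. All other monomials are mapped to `0`. -/
def mergeEdge (G : Graph α β) (e : β) (b : V(G)) : Module.End ℤ (MonomialCochain V(G) β) :=
  mulEdge V(G) e * (coeffVar β b * edgeProj V(G) {s | ∀ f ∈ s, ¬ G.Inc f b})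

lemma mergeEdge_eq_mulEdge_coeffVar {z : MonomialCochain V(G) β}
    (hz : z ∈ edgeSpan V(G) {s | ∀ f ∈ s, ¬ G.Inc f b}) :
    mergeEdge G e b z = mulEdge V(G) e (coeffVar β b z) := by
  simp only [mergeEdge, Module.End.mul_apply, edgeProj_eq_self hz]

lemma mergeEdge_eq_zero {f : β} (hf : G.Inc f b) {z : MonomialCochain V(G) β}
    (hz : z ∈ edgeSpan V(G) {s | f ∈ s}) : mergeEdge G e b z = 0 := by
  have hz' : z ∈ edgeSpan V(G) {s : Finset β | ∀ f ∈ s, ¬ G.Inc f b}ᶜ :=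
    edgeSpan_mono (fun s hs h => h f hs hf) hz
  simp only [mergeEdge, Module.End.mul_apply, edgeProj_eq_zero hz', map_zero]

lemma mergeEdge_mem_chromaticEnd (e : β) (b : V(G)) : mergeEdge G e b ∈ chromaticEnd G (1, -1) := by
  refine mul_mem_chromaticEnd (d' := (0, -1)) (mulEdge_mem_chromaticEnd e)
    ⟨relations_le_comap _ (fun s hs M => ?_) fun s f hf u v h M => ?_,
      mul_mem_homogeneousEnd (coeffVar_mem_homogeneousEnd b) (edgeProj_mem_homogeneousEnd _)⟩
  · exact mem_relations_of_mem_edgeSpan (coeffVar_mem_edgeSpan b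
      (edgeProj_mem_edgeSpan_of_mem _ (monomial_mem_edgeSpan hs M)))
  · have hmem (w : V(G)) : mulVar β w (monomial s M) ∈ edgeSpan V(G) {s} :=
      mulVar_mem_edgeSpan w (monomial_mem_edgeSpan (Set.mem_singleton s) M)
    by_cases hs : ∀ f ∈ s, ¬ G.Inc f b
    · have hcomm {w : V(G)} (hw : b ≠ w) :=
        (commute_coeffVar_mulVar hw).mul_left
          (commute_edgeProj_mulVar {s | ∀ f ∈ s, ¬ G.Inc f b} w)
      refine map_mulVar_sub_mulVar_mem_relations (hcomm ?_) (hcomm ?_)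
        (coeffVar_mem_edgeSpan b (edgeProj_mem_edgeSpan_of_mem _
          (monomial_mem_edgeSpan (component_eq_of_isLink hf h) M)))
      · rintro rfl
        exact hs f hf h.inc_left
      · rintro rfl
        exact hs f hf h.inc_right
    · have hle : ({s} : Set (Finset β)) ⊆ {s | ∀ f ∈ s, ¬ G.Inc f b}ᶜ :=
        Set.singleton_subset_iff.2 hs
      rw [Module.End.mul_apply, edgeProj_eq_zero (edgeSpan_mono hle
        (Submodule.sub_mem _ (hmem u) (hmem v))), map_zero]
      exact Submodule.zero_mem _

/-- The span of the monomials containing `e` and another edge at `b`. -/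
def doubleSpan (G : Graph α β) (e : β) (b : V(G)) : Submodule ℤ (MonomialCochain V(G) β) :=
  edgeSpan V(G) {s | e ∈ s ∧ ∃ f ∈ s, f ≠ e ∧ G.Inc f b}

lemma mulEdge_mem_doubleSpan {f : β} (hfe : f ≠ e) (hfb : G.Inc f b) {z : MonomialCochain V(G) β}
    (hz : z ∈ edgeSpan V(G) {s | f ∈ s}) : mulEdge V(G) e z ∈ doubleSpan G e b := by
  refine mulEdge_mem_edgeSpan ?_ hz
  intro s hs
  exact ⟨Finset.mem_insert_self e s, f, Finset.mem_insert_of_mem hs, hfe, hfb⟩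

lemma mulEdge_mergeEdge_add_mem_doubleSpan (f : β) (z : MonomialCochain V(G) β) :
    mulEdge V(G) f (mergeEdge G e b z) + mergeEdge G e b (mulEdge V(G) f z) ∈ doubleSpan G e b := by
  by_cases hfb : G.Inc f b
  · rw [mergeEdge_eq_zero hfb (mulEdge_mem_edgeSpan_mem f z), add_zero, mergeEdge,
      Module.End.mul_apply, ← Module.End.mul_apply (mulEdge V(G) f)]
    rcases eq_or_ne f e with rfl | hfe
    · rw [mulEdge_mul_self]
      exact Submodule.zero_mem _
    · rw [mulEdge_mul_mulEdge]
      exact Submodule.neg_mem _ (mulEdge_mem_doubleSpan hfe hfb (mulEdge_mem_edgeSpan_mem f _))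
  · have hcomm := (commute_mulEdge_coeffVar f b).mul_right (commute_mulEdge_edgeProj (V := V(G))
      (f := f) (𝒮 := {s | ∀ f ∈ s, ¬ G.Inc f b}) fun s => by simp [hfb])
    have hzero : mulEdge V(G) f * mergeEdge G e b + mergeEdge G e b * mulEdge V(G) f = 0 := by
      rw [mergeEdge, mul_assoc _ _ (mulEdge V(G) f), ← hcomm.eq, ← mul_assoc (mulEdge V(G) f),
        mulEdge_mul_mulEdge, neg_mul, mul_assoc, neg_add_cancel]
    rw [← Module.End.mul_apply, ← Module.End.mul_apply, ← LinearMap.add_apply, hzero]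
    exact Submodule.zero_mem _

lemma mulEdge_sub_mergeEdge_mem_sup (he : G.IsLink e a b) (hab : a ≠ b)
    {z : MonomialCochain V(G) β} (hz : z ∈ edgeSpan V(G) {s | e ∉ s}) :
    mulEdge V(G) e z - mergeEdge G e b ((mulVar β a + mulVar β b) z) ∈
      doubleSpan G e b ⊔ relations G := by
  refine map_mem_of_mem_edgeSpan (mulEdge V(G) e - mergeEdge G e b * (mulVar β a + mulVar β b))
    (fun s hes M => ?_) hz
  rw [LinearMap.sub_apply, Module.End.mul_apply]
  have hmem {𝒮 : Set (Finset β)} (hs : s ∈ 𝒮) :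
      (mulVar β a + mulVar β b) (monomial s M) ∈ edgeSpan V(G) 𝒮 :=
    Submodule.add_mem _ (mulVar_mem_edgeSpan a (monomial_mem_edgeSpan hs M))
      (mulVar_mem_edgeSpan b (monomial_mem_edgeSpan hs M))
  by_cases hs : ∀ g ∈ s, ¬ G.Inc g b
  · have hcoeff : 1 - coeffVar β b * (mulVar β a + mulVar β b) =
        -((mulVar β a - mulVar β b) * coeffVar β b) := by
      rw [mul_add, coeffVar_mul_mulVar_self, (commute_coeffVar_mulVar hab.symm).eq, sub_mul]
      abel
    have hedge : mulEdge V(G) e * (1 - coeffVar β b * (mulVar β a + mulVar β b)) =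
        -((mulVar β a - mulVar β b) * mulEdge V(G) e * coeffVar β b) := by
      rw [hcoeff, mul_neg, ← mul_assoc,
        ((commute_mulEdge_mulVar e a).sub_right (commute_mulEdge_mulVar e b)).eq]
    have hjoined : mulEdge V(G) e (coeffVar β b (monomial s M)) ∈
        edgeSpan V(G) {s | component G s a = component G s b} := by
      refine edgeSpan_mono ?_ (mulEdge_mem_edgeSpan_mem e _)
      exact fun s hs => component_eq_of_isLink hs he
    rw [mergeEdge_eq_mulEdge_coeffVar (hmem hs), ← map_sub]
    refine Submodule.mem_sup_right ?_
    convert Submodule.neg_mem _ (mulVar_sub_mulVar_mem_relations hjoined)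
    exact LinearMap.congr_fun hedge (monomial s M)
  · push Not at hs
    obtain ⟨g, hg, hgb⟩ := hs
    rw [mergeEdge_eq_zero hgb (hmem hg), sub_zero]
    exact Submodule.mem_sup_left (mulEdge_mem_doubleSpan (ne_of_mem_of_not_mem hg hes) hgb
      (monomial_mem_edgeSpan hg M))

end Merge

section PathHomotopy

section

variable {V β : Type*} [DecidableEq V] [LinearOrder β]

/-- The comultiplication along a path `b, u, p, a` of length three with edges `f₁`, `f₃`, `f₂`. The
signs are chosen so that it is a null-homotopy of `x_a + x_b`. -/
def pathComul (f₁ f₂ f₃ : β) (a b u p : V) : Module.End ℤ (MonomialCochain V β) :=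
  comulEdge f₁ u b + comulEdge f₂ p a - comulEdge f₃ u p

end

open scoped Classical

variable {α β : Type*} [LinearOrder β] {G : Graph α β} {e f₁ f₂ f₃ : β} {a b u p : V(G)}

lemma pathComul_mem_chromaticEnd (h₁ : G.IsLink f₁ u b) (h₂ : G.IsLink f₂ p a)
    (h₃ : G.IsLink f₃ u p) : pathComul f₁ f₂ f₃ a b u p ∈ chromaticEnd G (-1, 1) :=
  Submodule.sub_mem _ (Submodule.add_mem _ (comulEdge_mem_chromaticEnd h₁)
    (comulEdge_mem_chromaticEnd h₂)) (comulEdge_mem_chromaticEnd h₃)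

/-- A null-homotopy of the addition of the edge `e` with ends `a` and `b`, up to `doubleSpan`. -/
def pathHomotopy (G : Graph α β) (e f₁ f₂ f₃ : β) (a b u p : V(G)) :
    Module.End ℤ (MonomialCochain V(G) β) :=
  mergeEdge G e b * pathComul f₁ f₂ f₃ a b u p

lemma pathHomotopy_mem_chromaticEnd (h₁ : G.IsLink f₁ u b) (h₂ : G.IsLink f₂ p a)
    (h₃ : G.IsLink f₃ u p) : pathHomotopy G e f₁ f₂ f₃ a b u p ∈ chromaticEnd G 0 :=
  mul_mem_chromaticEnd (mergeEdge_mem_chromaticEnd e b) (pathComul_mem_chromaticEnd h₁ h₂ h₃)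

lemma pathHomotopy_mem_edgeSpan (z : MonomialCochain V(G) β) :
    pathHomotopy G e f₁ f₂ f₃ a b u p z ∈ edgeSpan V(G) {s | e ∈ s} :=
  mulEdge_mem_edgeSpan_mem e _

lemma pathHomotopy_eq_zero (he : G.Inc e b) (h₁ : f₁ ≠ e) (h₂ : f₂ ≠ e) (h₃ : f₃ ≠ e)
    {z : MonomialCochain V(G) β} (hz : z ∈ edgeSpan V(G) {s | e ∈ s}) :
    pathHomotopy G e f₁ f₂ f₃ a b u p z = 0 := by
  have hmem {f : β} (hf : f ≠ e) (v w : V(G)) :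
      comulEdge f v w z ∈ edgeSpan V(G) {s | e ∈ s} := by
    have hremove : removeEdge V(G) f z ∈ edgeSpan V(G) {s | e ∈ s} := by
      refine removeEdge_mem_edgeSpan ?_ hz
      exact fun s hs _ => Finset.mem_erase_of_ne_of_mem hf.symm hs
    rw [comulEdge, Module.End.mul_apply, LinearMap.add_apply]
    exact Submodule.add_mem _ (mulVar_mem_edgeSpan v hremove) (mulVar_mem_edgeSpan w hremove)
  rw [pathHomotopy, Module.End.mul_apply, pathComul, LinearMap.sub_apply, LinearMap.add_apply]
  exact mergeEdge_eq_zero he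
    (Submodule.sub_mem _ (Submodule.add_mem _ (hmem h₁ u b) (hmem h₂ p a)) (hmem h₃ u p))

variable [Fintype β]

lemma monomialDifferential_mergeEdge_add_mem_doubleSpan (e : β) (b : V(G))
    (z : MonomialCochain V(G) β) :
    monomialDifferential G (mergeEdge G e b z) + mergeEdge G e b (monomialDifferential G z) ∈
      doubleSpan G e b := by
  simp only [monomialDifferential, LinearMap.sum_apply, map_sum, ← Finset.sum_add_distrib]
  exact Submodule.sum_mem _ fun f _ => mulEdge_mergeEdge_add_mem_doubleSpan f z

lemma monomialDifferential_mul_pathComul (h₁ : f₁ ∈ E(G)) (h₂ : f₂ ∈ E(G)) (h₃ : f₃ ∈ E(G)) :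
    monomialDifferential G * pathComul f₁ f₂ f₃ a b u p +
      pathComul f₁ f₂ f₃ a b u p * monomialDifferential G = mulVar β a + mulVar β b := by
  have hsum : mulVar β a + mulVar β b =
      (mulVar β u + mulVar β b) + (mulVar β p + mulVar β a) - (mulVar β u + mulVar β p) := by abel
  rw [hsum, ← monomialDifferential_mul_comulEdge h₁, ← monomialDifferential_mul_comulEdge h₂,
    ← monomialDifferential_mul_comulEdge h₃, pathComul, mul_sub, mul_add, sub_mul, add_mul]
  abel

lemma pathHomotopy_defect_mem_sup (he : G.IsLink e a b) (hab : a ≠ b) (h₁ : G.IsLink f₁ u b)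
    (h₂ : G.IsLink f₂ p a) (h₃ : G.IsLink f₃ u p) (h₁e : f₁ ≠ e) (h₂e : f₂ ≠ e) (h₃e : f₃ ≠ e)
    {z : MonomialCochain V(G) β} (hz : z ∈ edgeSpan V(G) {s | e ∉ s}) :
    monomialDifferential G ((1 + pathHomotopy G e f₁ f₂ f₃ a b u p) z) -
      (1 + pathHomotopy G e f₁ f₂ f₃ a b u p) (monomialDifferential G z - mulEdge V(G) e z) ∈
        doubleSpan G e b ⊔ relations G := by
  have hnull := LinearMap.congr_fun (monomialDifferential_mul_pathComul (G := G) (a := a) (b := b)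
    (u := u) (p := p) h₁.edge_mem h₂.edge_mem h₃.edge_mem) z
  have hmerge := monomialDifferential_mergeEdge_add_mem_doubleSpan e b
    (pathComul f₁ f₂ f₃ a b u p z)
  have hedge := mulEdge_sub_mergeEdge_mem_sup he hab hz
  rw [← hnull, LinearMap.add_apply, map_add] at hedge
  convert Submodule.add_mem _ (Submodule.mem_sup_left (T := relations G) hmerge) hedge using 1
  simp only [LinearMap.add_apply, Module.End.one_apply, map_add, map_sub,
    pathHomotopy_eq_zero he.inc_right h₁e h₂e h₃e (mulEdge_mem_edgeSpan_mem e z)]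
  simp only [pathHomotopy, Module.End.mul_apply]
  abel

end PathHomotopy

section Bidegree

variable {α β : Type*} {G H K : Graph α β}

/-- The map `φ` raises the bidegree by `d`. -/
def HasBidegree (φ : Cochain G →ₗ[ℤ] Cochain H) (d : ℤ × ℤ) : Prop :=
  ∀ i j, bigradedPart G i j ≤ (bigradedPart H (i + d.1) (j + d.2)).comap φ

lemma single_mem_bigradedPart {S : EnhancedState G} {i j : ℤ} (hi : (S.edges.card : ℤ) = i)
    (hj : (S.xCount : ℤ) = j) : Finsupp.single S 1 ∈ bigradedPart G i j :=
  Finsupp.single_mem_supported _ _ ⟨hi, hj⟩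

namespace HasBidegree

lemma comp {ψ : Cochain H →ₗ[ℤ] Cochain K} {φ : Cochain G →ₗ[ℤ] Cochain H} {d d' d'' : ℤ × ℤ}
    (hψ : HasBidegree ψ d) (hφ : HasBidegree φ d') (h : d' + d = d'' := by decide) :
    HasBidegree (ψ ∘ₗ φ) d'' := by
  subst h
  intro i j z hz
  rw [Prod.fst_add, Prod.snd_add, ← add_assoc, ← add_assoc]
  exact hψ _ _ (hφ i j hz)

lemma sub {φ ψ : Cochain G →ₗ[ℤ] Cochain H} {d : ℤ × ℤ} (hφ : HasBidegree φ d)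
    (hψ : HasBidegree ψ d) : HasBidegree (φ - ψ) d := by
  intro i j z hz
  rw [Submodule.mem_comap, LinearMap.sub_apply]
  exact Submodule.sub_mem _ (hφ i j hz) (hψ i j hz)

lemma bigradedPart_le_comap {φ : Cochain G →ₗ[ℤ] Cochain H} {d : ℤ × ℤ} (hφ : HasBidegree φ d)
    {i i' j j' : ℤ} (hi : i + d.1 = i') (hj : j + d.2 = j') :
    bigradedPart G i j ≤ (bigradedPart H i' j').comap φ :=
  hi ▸ hj ▸ hφ i j

lemma of_single {φ : Cochain G →ₗ[ℤ] Cochain H} {d : ℤ × ℤ}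
    (h : ∀ S, φ (Finsupp.single S 1) ∈ bigradedPart H (S.edges.card + d.1) (S.xCount + d.2)) :
    HasBidegree φ d := by
  intro i j
  rw [bigradedPart, Finsupp.supported_eq_span_single, Submodule.span_le]
  rintro _ ⟨S, ⟨rfl, rfl⟩, rfl⟩
  exact h S

lemma gradedPart_le_comap {φ : Cochain G →ₗ[ℤ] Cochain H} {d : ℤ × ℤ} (hφ : HasBidegree φ d)
    {i i' : ℤ} (hi : i + d.1 = i') : gradedPart G i ≤ (gradedPart H i').comap φ := by
  subst hi
  rw [gradedPart, Finsupp.supported_eq_span_single, Submodule.span_le]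
  rintro _ ⟨S, hS, rfl⟩
  exact Finsupp.supported_mono (R := ℤ) (fun T hT => hT.1)
    (hφ i S.xCount (single_mem_bigradedPart hS rfl))

end HasBidegree

lemma hasBidegree_id : HasBidegree (LinearMap.id : Cochain G →ₗ[ℤ] Cochain G) 0 := by
  intro i j z hz
  rwa [Prod.fst_zero, Prod.snd_zero, add_zero, add_zero]

lemma hasBidegree_differential [LinearOrder β] [Fintype β] (G : Graph α β) :
    HasBidegree (differential G) (1, 0) := by
  intro i j
  simpa only [add_zero] using differential_bigradedPart G i j

lemma hasBidegree_beta [LinearOrder β] (G : Graph α β) (e : β) : HasBidegree (beta G e) 0 := by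
  intro i j
  simpa only [Prod.fst_zero, Prod.snd_zero, add_zero] using beta_bigradedPart G e i j

open scoped Classical

lemma toCochain_mem_bigradedPart {i j : ℤ} {z : MonomialCochain V(G) β}
    (hz : z ∈ monomialPart V(G) β (i, j)) : toCochain G z ∈ bigradedPart G i j := by
  refine map_mem_of_mem_monomialSpan _ (fun s M hs => ?_) hz
  by_cases h : (s : Set β) ⊆ E(G) ∧ Set.InjOn (component G s) M
  · rw [toCochain_monomial_of_injOn h.1 h.2]
    exact single_mem_bigradedPart (congrArg Prod.fst hs)
      ((congrArg _ (xCount_markedState h.1 h.2)).trans (congrArg Prod.snd hs))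
  · rw [toCochain_monomial_of_not h]
    exact Submodule.zero_mem _

lemma toMonomial_mem_monomialPart [Finite V(G)] {i j : ℤ} {z : Cochain G}
    (hz : z ∈ bigradedPart G i j) : toMonomial G z ∈ monomialPart V(G) β (i, j) := by
  rw [bigradedPart, Finsupp.supported_eq_span_single] at hz
  refine Submodule.span_le (p := (monomialPart V(G) β (i, j)).comap (toMonomial G)).2 ?_ hz
  rintro _ ⟨S, hS, rfl⟩
  rw [SetLike.mem_coe, Submodule.mem_comap, toMonomial_single]
  exact monomial_mem_monomialPart hS.1 ((congrArg _ S.card_marks).trans hS.2)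

lemma hasBidegree_descend [Finite V(G)] {φ : Module.End ℤ (MonomialCochain V(G) β)} {d : ℤ × ℤ}
    (hφ : φ ∈ chromaticEnd G d) : HasBidegree (descend φ) d := fun i j _ hz =>
  toCochain_mem_bigradedPart
    (mem_homogeneousEnd.1 hφ.2 (i, j) _ (toMonomial_mem_monomialPart hz))

end Bidegree

section Extension

variable {α β : Type*} {G : Graph α β} {e : β}

/-- An enhanced state of `G - e` as an enhanced state of `G`. -/
def extendState (S : EnhancedState (deletion G e)) : EnhancedState G where
  edges := S.edges
  edges_subset f hf := (S.edges_subset hf).1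
  colour v := S.colour ⟨v, by simp⟩
  colour_eq := by
    rintro u v ⟨f, hf, h⟩
    exact S.colour_eq _ _ ⟨f, hf, h, (S.edges_subset hf).2⟩

lemma notMem_edges_extendState (S : EnhancedState (deletion G e)) : e ∉ (extendState S).edges :=
  fun h => (S.edges_subset h).2 rfl

lemma extendState_restrictState (S : EnhancedState G) (hS : e ∉ S.edges) :
    extendState (restrictState S hS) = S :=
  rfl

lemma restrictState_extendState (S : EnhancedState (deletion G e)) :
    restrictState (extendState S) (notMem_edges_extendState S) = S :=
  rfl

/-- The inclusion of the cochains of `G - e` into those of `G`. It commutes with the differentials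
only up to the addition of the edge `e`. -/
def extendCochain (G : Graph α β) (e : β) : Cochain (deletion G e) →ₗ[ℤ] Cochain G :=
  Finsupp.lmapDomain ℤ ℤ extendState

lemma extendCochain_single (S : EnhancedState (deletion G e)) :
    extendCochain G e (Finsupp.single S 1) = Finsupp.single (extendState S) 1 :=
  Finsupp.mapDomain_single

lemma toMonomial_extendCochain_mem [Finite V(G)] (y : Cochain (deletion G e)) :
    toMonomial G (extendCochain G e y) ∈ edgeSpan V(G) {s | e ∉ s} := by
  induction y using Finsupp.induction_linear with
  | zero => simp only [map_zero, Submodule.zero_mem]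
  | add y y' h h' => rw [map_add, map_add]; exact Submodule.add_mem _ h h'
  | single S c =>
    rw [← mul_one c, ← smul_eq_mul, ← Finsupp.smul_single, map_smul, map_smul,
      extendCochain_single, toMonomial_single]
    exact Submodule.smul_mem _ _ (monomial_mem_edgeSpan (notMem_edges_extendState S) _)

variable [LinearOrder β]

lemma hasBidegree_extendCochain (G : Graph α β) (e : β) : HasBidegree (extendCochain G e) 0 := by
  refine HasBidegree.of_single fun S => ?_
  rw [extendCochain_single]
  refine single_mem_bigradedPart (add_zero _).symm ?_
  rw [← xCount_restrictState _ (notMem_edges_extendState S), restrictState_extendState]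
  exact (add_zero _).symm

lemma beta_extendCochain (y : Cochain (deletion G e)) : beta G e (extendCochain G e y) = y := by
  suffices h : beta G e ∘ₗ extendCochain G e = LinearMap.id from LinearMap.congr_fun h y
  refine Finsupp.lhom_ext' fun S => LinearMap.ext_ring ?_
  simp only [LinearMap.comp_apply, Finsupp.lsingle_apply, extendCochain_single, beta_single,
    dif_neg (notMem_edges_extendState S), restrictState_extendState, LinearMap.id_apply]

open scoped Classical

lemma extendCochain_beta_toCochain (z : MonomialCochain V(G) β) :
    extendCochain G e (beta G e (toCochain G z)) =
      toCochain G (edgeProj V(G) {s | e ∉ s} z) := by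
  suffices h : extendCochain G e ∘ₗ beta G e ∘ₗ toCochain G =
    toCochain G ∘ₗ edgeProj V(G) {s | e ∉ s} from LinearMap.congr_fun h z
  refine monomial_ext fun s M => ?_
  simp only [LinearMap.comp_apply]
  by_cases h : (s : Set β) ⊆ E(G) ∧ Set.InjOn (component G s) M
  · rw [toCochain_monomial_of_injOn h.1 h.2, beta_single]
    by_cases hs : e ∈ s
    · rw [dif_pos (show e ∈ (markedState G s h.1 M).edges from hs), map_zero,
        edgeProj_monomial_of_notMem (not_not.2 hs), map_zero]
    · rw [dif_neg (show e ∉ (markedState G s h.1 M).edges from hs), extendCochain_single,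
        extendState_restrictState, edgeProj_monomial_of_mem hs,
        toCochain_monomial_of_injOn h.1 h.2]
  · rw [toCochain_monomial_of_not h, map_zero, map_zero]
    by_cases hs : e ∈ s
    · rw [edgeProj_monomial_of_notMem (not_not.2 hs), map_zero]
    · rw [edgeProj_monomial_of_mem hs, toCochain_monomial_of_not h]

lemma beta_toCochain_eq_zero {z : MonomialCochain V(G) β} (hz : z ∈ edgeSpan V(G) {s | e ∈ s}) :
    beta G e (toCochain G z) = 0 := by
  have hz' : z ∈ edgeSpan V(G) {s : Finset β | e ∉ s}ᶜ :=
    edgeSpan_mono (fun _ hs => not_not.2 hs) hz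
  rw [← beta_extendCochain (beta G e (toCochain G z)), extendCochain_beta_toCochain,
    edgeProj_eq_zero hz', map_zero, map_zero]

variable [Fintype β]

lemma edgeProj_monomialDifferential (he : e ∈ E(G)) {z : MonomialCochain V(G) β}
    (hz : z ∈ edgeSpan V(G) {s | e ∉ s}) :
    edgeProj V(G) {s | e ∉ s} (monomialDifferential G z) =
      monomialDifferential G z - mulEdge V(G) e z := by
  have hcompl : mulEdge V(G) e z ∈ edgeSpan V(G) {s : Finset β | e ∉ s}ᶜ :=
    edgeSpan_mono (fun _ hs => not_not.2 hs) (mulEdge_mem_edgeSpan_mem e z)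
  have hother : monomialDifferential G z - mulEdge V(G) e z ∈ edgeSpan V(G) {s | e ∉ s} := by
    rw [monomialDifferential, LinearMap.sum_apply, ← Finset.sum_erase_eq_sub
      (Finset.mem_filter.2 ⟨Finset.mem_univ e, he⟩)]
    refine Submodule.sum_mem _ fun f hf => mulEdge_mem_edgeSpan ?_ hz
    intro s hs hes
    rcases Finset.mem_insert.1 hes with h | h
    · exact Finset.ne_of_mem_erase hf h.symm
    · exact hs h
  rw [← edgeProj_eq_self hother, map_sub, edgeProj_eq_zero hcompl, sub_zero]

lemma extendCochain_differential [Finite V(G)] (he : e ∈ E(G)) (y : Cochain (deletion G e)) :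
    extendCochain G e (differential (deletion G e) y) =
      toCochain G (monomialDifferential G (toMonomial G (extendCochain G e y)) -
        mulEdge V(G) e (toMonomial G (extendCochain G e y))) := by
  have hbeta : differential (deletion G e) y =
      beta G e (differential G (extendCochain G e y)) := by
    rw [← LinearMap.comp_apply (beta G e), beta_comp_differential, LinearMap.comp_apply,
      beta_extendCochain]
  rw [← edgeProj_monomialDifferential he (toMonomial_extendCochain_mem y),
    ← extendCochain_beta_toCochain, ← differential_toCochain, toCochain_toMonomial, hbeta]

end Extension

section ChainSection

lemma exists_chain_section {R M N : Type*} [Ring R] [AddCommGroup M] [AddCommGroup N] [Module R M]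
    [Module R N] {d : Module.End R M} {d' : Module.End R N} (hd : d ∘ₗ d = 0) (hd' : d' ∘ₗ d' = 0)
    {ψ : M →ₗ[R] N} {τ : N →ₗ[R] M} {κ : Module.End R M} {L : Submodule R M}
    (hτ : ∀ y, ψ (τ y) = y) (hτL : ∀ y, d (τ y) - τ (d' y) ∈ L) (hκ : Contracts d κ L)
    (hψκ : ∀ z, ψ (κ z) = 0) :
    ∃ σ : N →ₗ[R] M, σ = τ - κ ∘ₗ (d ∘ₗ τ - τ ∘ₗ d') ∧ σ ∘ₗ d' = d ∘ₗ σ ∧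
      ψ ∘ₗ σ = LinearMap.id := by
  have hdd (z : M) : d (d z) = 0 := LinearMap.congr_fun hd z
  have hdd' (y : N) : d' (d' y) = 0 := LinearMap.congr_fun hd' y
  refine ⟨_, rfl, ?_, ?_⟩ <;> ext y
  · have h := hκ _ (hτL y)
    simp only [LinearMap.add_apply, Module.End.mul_apply, map_sub, hdd, map_zero] at h
    simp only [LinearMap.comp_apply, LinearMap.sub_apply, map_sub, hdd', map_zero, sub_zero]
    rw [← sub_eq_zero, ← sub_eq_zero.2 h]
    abel
  · simp only [LinearMap.comp_apply, LinearMap.sub_apply, map_sub, hτ, hψκ, sub_zero,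
      LinearMap.id_apply]

open scoped Classical

variable {α β : Type*} [LinearOrder β] {G : Graph α β} {e f₁ f₂ f₃ : β} {a b u p : V(G)}

lemma one_add_pathHomotopy_mem_chromaticEnd (h₁ : G.IsLink f₁ u b) (h₂ : G.IsLink f₂ p a)
    (h₃ : G.IsLink f₃ u p) : 1 + pathHomotopy G e f₁ f₂ f₃ a b u p ∈ chromaticEnd G 0 :=
  Submodule.add_mem _ one_mem_chromaticEnd (pathHomotopy_mem_chromaticEnd h₁ h₂ h₃)

variable [Finite V(G)]

/-- The section `y ↦ y + W y` of `β`, where `W` is `pathHomotopy`. It is a chain map up to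
`doubleSpan`. -/
def almostSection (G : Graph α β) [Finite V(G)] (e f₁ f₂ f₃ : β) (a b u p : V(G)) :
    Cochain (deletion G e) →ₗ[ℤ] Cochain G :=
  descend (1 + pathHomotopy G e f₁ f₂ f₃ a b u p) ∘ₗ extendCochain G e

lemma hasBidegree_almostSection (h₁ : G.IsLink f₁ u b) (h₂ : G.IsLink f₂ p a)
    (h₃ : G.IsLink f₃ u p) : HasBidegree (almostSection G e f₁ f₂ f₃ a b u p) 0 :=
  (hasBidegree_descend (one_add_pathHomotopy_mem_chromaticEnd h₁ h₂ h₃)).comp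
    (hasBidegree_extendCochain G e)

lemma beta_almostSection (y : Cochain (deletion G e)) :
    beta G e (almostSection G e f₁ f₂ f₃ a b u p y) = y := by
  simp only [almostSection, descend, LinearMap.comp_apply, LinearMap.add_apply,
    Module.End.one_apply, map_add, toCochain_toMonomial, beta_extendCochain,
    beta_toCochain_eq_zero (pathHomotopy_mem_edgeSpan _), add_zero]

lemma almostSection_defect_mem [Fintype β] (he : G.IsLink e a b) (hab : a ≠ b)
    (h₁ : G.IsLink f₁ u b) (h₂ : G.IsLink f₂ p a) (h₃ : G.IsLink f₃ u p) (h₁e : f₁ ≠ e)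
    (h₂e : f₂ ≠ e) (h₃e : f₃ ≠ e) (y : Cochain (deletion G e)) :
    differential G (almostSection G e f₁ f₂ f₃ a b u p y) -
      almostSection G e f₁ f₂ f₃ a b u p (differential (deletion G e) y) ∈
        (doubleSpan G e b).map (toCochain G) := by
  obtain ⟨z, hz, r, hr, hzr⟩ := Submodule.mem_sup.1
    (pathHomotopy_defect_mem_sup he hab h₁ h₂ h₃ h₁e h₂e h₃e (toMonomial_extendCochain_mem y))
  refine ⟨z, hz, ?_⟩
  have hz_image : toCochain G z = toCochain G (z + r) := by
    rw [map_add, LinearMap.mem_ker.1 (relations_le_ker_toCochain hr), add_zero]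
  have happly : almostSection G e f₁ f₂ f₃ a b u p y = toCochain G
      ((1 + pathHomotopy G e f₁ f₂ f₃ a b u p) (toMonomial G (extendCochain G e y))) := rfl
  rw [hz_image, hzr, map_sub, happly, differential_toCochain, almostSection, LinearMap.comp_apply,
    extendCochain_differential he.edge_mem,
    descend_toCochain (one_add_pathHomotopy_mem_chromaticEnd h₁ h₂ h₃)]

end ChainSection

section SplittingEdge

open scoped Classical

variable {α β : Type*} {G : Graph α β} {e : β} {a b : V(G)}

/-- The condition on the edge `e` with ends `a` and `b` under which `β` has a section that is a
chain map: every edge `f ≠ e` at `b` lies in a triangle with `e`, and there is a walk `b, u, p, a`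
of length three that avoids `e` and does not return to `b`. -/
structure IsSplittingEdge (G : Graph α β) (e : β) (a b : V(G)) : Prop where
  isLink : G.IsLink e a b
  ne : a ≠ b
  triangle : ∀ (f : β) (t : V(G)), f ≠ e → G.IsLink f t b → t ≠ b ∧ G.Adj t a
  exists_path : ∃ (u p : V(G)) (f : β),
    f ≠ e ∧ G.IsLink f u b ∧ p ≠ b ∧ G.Adj u p ∧ G.Adj p a

lemma not_inc_of_isLink {f : β} {u v w : V(G)} (h : G.IsLink f u v) (hu : u ≠ w) (hv : v ≠ w) :
    ¬ G.Inc f w := fun hw => by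
  rcases hw.eq_or_eq_of_isLink h with h | h
  · exact hu (Subtype.ext h.symm)
  · exact hv (Subtype.ext h.symm)

namespace IsSplittingEdge

variable [LinearOrder β] [Fintype β]

lemma exists_contracts_doubleSpan (h : IsSplittingEdge G e a b) :
    ∃ κ ∈ chromaticEnd G (-1, 0), (∀ z, κ z ∈ edgeSpan V(G) {s | e ∈ s}) ∧
      Contracts (monomialDifferential G) κ (doubleSpan G e b) := by
  obtain ⟨κ, hκ, hκe, hcontr⟩ := exists_contracts_edgeSpan h.isLink
    {f : β | f ≠ e ∧ G.Inc f b} (by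
      intro f hf
      obtain ⟨hfe, t, ht⟩ := (Finset.mem_filter.1 hf).2
      obtain ⟨htb, g, hg⟩ := h.triangle f ⟨t, ht.right_mem⟩ hfe ht.symm
      have hgb := not_inc_of_isLink hg htb h.ne
      refine ⟨_, g, ht.symm, hg, ?_, fun hgF => hgb (Finset.mem_filter.1 hgF).2.2⟩
      rintro rfl
      exact hgb h.isLink.inc_right)
  refine ⟨κ, hκ, hκe, fun z hz => hcontr z (edgeSpan_mono ?_ hz)⟩
  rintro s ⟨hes, f, hfs, hf⟩
  exact ⟨hes, f, Finset.mem_filter.2 ⟨Finset.mem_univ f, hf⟩, hfs⟩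

theorem exists_chain_section_beta [Finite V(G)] (h : IsSplittingEdge G e a b) :
    ∃ σ : Cochain (deletion G e) →ₗ[ℤ] Cochain G,
      σ ∘ₗ differential (deletion G e) = differential G ∘ₗ σ ∧
      beta G e ∘ₗ σ = LinearMap.id ∧ HasBidegree σ 0 := by
  obtain ⟨u, p, f₁, h₁e, h₁, hp, ⟨f₃, h₃⟩, f₂, h₂⟩ := h.exists_path
  have hne {f : β} {v w : V(G)} (hf : G.IsLink f v w) (hv : v ≠ b) (hw : w ≠ b) : f ≠ e := by
    rintro rfl
    exact not_inc_of_isLink hf hv hw h.isLink.inc_right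
  have hτL := almostSection_defect_mem h.isLink h.ne h₁ h₂ h₃ h₁e (hne h₂ hp h.ne)
    (hne h₃ (h.triangle f₁ u h₁e h₁).1 hp)
  have hτ := hasBidegree_almostSection (e := e) h₁ h₂ h₃
  obtain ⟨κ, hκ, hκe, hcontr⟩ := h.exists_contracts_doubleSpan
  have hcontr' : Contracts (differential G) (descend κ)
      ((doubleSpan G e b).map (toCochain G)) := by
    rintro _ ⟨z, hz, rfl⟩
    rw [LinearMap.add_apply, Module.End.mul_apply, Module.End.mul_apply, descend_toCochain hκ,
      differential_toCochain, differential_toCochain, descend_toCochain hκ, ← map_add]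
    exact congrArg _ (hcontr z hz)
  obtain ⟨σ, rfl, hσ, hβσ⟩ := exists_chain_section (differential_comp_differential G)
    (differential_comp_differential (deletion G e)) beta_almostSection hτL hcontr'
    fun z => beta_toCochain_eq_zero (hκe _)
  refine ⟨_, hσ, hβσ, hτ.sub ((hasBidegree_descend hκ).comp (d' := (1, 0)) ?_)⟩
  exact ((hasBidegree_differential G).comp hτ).sub (hτ.comp (hasBidegree_differential _))

end IsSplittingEdge

end SplittingEdge

section SplitExact

lemma IsSplitExact.of_biproduct {A B C : Type*} [AddCommGroup A] [AddCommGroup B] [AddCommGroup C]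
    {f : A →ₗ[ℤ] B} {g : B →ₗ[ℤ] C} {r : B →ₗ[ℤ] A} {s : C →ₗ[ℤ] B}
    (hrf : r ∘ₗ f = LinearMap.id) (hgs : g ∘ₗ s = LinearMap.id)
    (hsum : f ∘ₗ r + s ∘ₗ g = LinearMap.id) : IsSplitExact f g := by
  have hgs' := LinearMap.congr_fun hgs
  have hrf' := LinearMap.congr_fun hrf
  have hsum' := LinearMap.congr_fun hsum
  simp only [LinearMap.comp_apply, LinearMap.add_apply, LinearMap.id_apply] at hgs' hrf' hsum'
  refine ⟨Function.LeftInverse.injective hrf', fun y => ⟨fun hy => ⟨r y, ?_⟩, ?_⟩,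
    Function.RightInverse.surjective hgs', s, hgs⟩
  · simpa only [hy, map_zero, add_zero] using hsum' y
  · rintro ⟨x, rfl⟩
    have hsgf : s (g (f x)) = 0 := by simpa only [hrf', add_eq_left] using hsum' (f x)
    rw [← hgs' (g (f x)), hsgf, map_zero]

variable {M₁ M M₂ : Type*} [AddCommGroup M₁] [AddCommGroup M] [AddCommGroup M₂]
  {d₁ : M₁ →ₗ[ℤ] M₁} {d : M →ₗ[ℤ] M} {d₂ : M₂ →ₗ[ℤ] M₂}
  {P₁ Q₁ : Submodule ℤ M₁} {P Q : Submodule ℤ M} {P₂ Q₂ : Submodule ℤ M₂}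

lemma isSplitExact_homologyAtMap {φ : M₁ →ₗ[ℤ] M} {ψ : M →ₗ[ℤ] M₂} {ρ : M →ₗ[ℤ] M₁}
    {σ : M₂ →ₗ[ℤ] M} (hφ : φ ∘ₗ d₁ = d ∘ₗ φ) (hψ : ψ ∘ₗ d = d₂ ∘ₗ ψ) (hρ : ρ ∘ₗ d = d₁ ∘ₗ ρ)
    (hσ : σ ∘ₗ d₂ = d ∘ₗ σ) (hφP : P₁ ≤ P.comap φ) (hφQ : Q₁ ≤ Q.comap φ) (hψP : P ≤ P₂.comap ψ)
    (hψQ : Q ≤ Q₂.comap ψ) (hρP : P ≤ P₁.comap ρ) (hρQ : Q ≤ Q₁.comap ρ) (hσP : P₂ ≤ P.comap σ)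
    (hσQ : Q₂ ≤ Q.comap σ) (hρφ : ρ ∘ₗ φ = LinearMap.id) (hψσ : ψ ∘ₗ σ = LinearMap.id)
    (hsum : φ ∘ₗ ρ + σ ∘ₗ ψ = LinearMap.id) :
    IsSplitExact (homologyAtMap φ hφ hφP hφQ) (homologyAtMap ψ hψ hψP hψQ) := by
  refine .of_biproduct (r := homologyAtMap ρ hρ hρP hρQ) (s := homologyAtMap σ hσ hσP hσQ) ?_ ?_ ?_
  · ext ⟨z, hz⟩
    exact congrArg Submodule.Quotient.mk (Subtype.ext (LinearMap.congr_fun hρφ z))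
  · ext ⟨z, hz⟩
    exact congrArg Submodule.Quotient.mk (Subtype.ext (LinearMap.congr_fun hψσ z))
  · ext ⟨z, hz⟩
    exact congrArg Submodule.Quotient.mk (Subtype.ext (LinearMap.congr_fun hsum z))

lemma exists_chain_retraction {φ : M₁ →ₗ[ℤ] M} {ψ : M →ₗ[ℤ] M₂} {ρ₀ : M →ₗ[ℤ] M₁}
    {s₀ : M₂ →ₗ[ℤ] M} {σ : M₂ →ₗ[ℤ] M} (hφ : φ ∘ₗ d₁ = d ∘ₗ φ) (hψ : ψ ∘ₗ d = d₂ ∘ₗ ψ)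
    (hσ : σ ∘ₗ d₂ = d ∘ₗ σ) (hρφ : ρ₀ ∘ₗ φ = LinearMap.id) (hψσ : ψ ∘ₗ σ = LinearMap.id)
    (hψφ : ψ ∘ₗ φ = 0) (hsum : φ ∘ₗ ρ₀ + s₀ ∘ₗ ψ = LinearMap.id) :
    ∃ ρ : M →ₗ[ℤ] M₁, ρ = ρ₀ ∘ₗ (LinearMap.id - σ ∘ₗ ψ) ∧ ρ ∘ₗ d = d₁ ∘ₗ ρ ∧
      ρ ∘ₗ φ = LinearMap.id ∧ φ ∘ₗ ρ + σ ∘ₗ ψ = LinearMap.id := by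
  have hφ' := LinearMap.congr_fun hφ
  have hψ' := LinearMap.congr_fun hψ
  have hσ' := LinearMap.congr_fun hσ
  have hρφ' := LinearMap.congr_fun hρφ
  have hψσ' := LinearMap.congr_fun hψσ
  have hψφ' := LinearMap.congr_fun hψφ
  have hsum' := LinearMap.congr_fun hsum
  simp only [LinearMap.comp_apply, LinearMap.add_apply, LinearMap.id_apply,
    LinearMap.zero_apply] at hφ' hψ' hσ' hρφ' hψσ' hψφ' hsum'
  have hφρ (z : M) : φ (ρ₀ (z - σ (ψ z))) = z - σ (ψ z) := by
    simpa only [map_sub, hψσ', sub_self, map_zero, add_zero] using hsum' (z - σ (ψ z))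
  refine ⟨_, rfl, ?_, ?_, ?_⟩ <;> ext z <;>
    simp only [LinearMap.comp_apply, LinearMap.add_apply, LinearMap.sub_apply, LinearMap.id_apply]
  · rw [← hρφ' (d₁ _), hφ', hφρ, hψ', hσ', map_sub d]
  · rw [hψφ', map_zero, sub_zero, hρφ']
  · rw [hφρ, sub_add_cancel]

end SplitExact

section ShortExact

variable {α β : Type*} [LinearOrder β] {G : Graph α β} {e : β} {a b : α}

/-- The enhanced state of `G / e` whose image under `liftState` is `S`. Since `e` belongs to `S`,
the colour of a vertex of `G / e` may be read off at any vertex above it. -/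
def contractState (he : G.IsLink e a b) (S : EnhancedState G) (hS : e ∈ S.edges) :
    EnhancedState (contraction G e a b) where
  edges := S.edges.erase e
  edges_subset f hf := by
    rw [Finset.mem_coe, Finset.mem_erase] at hf
    exact ⟨S.edges_subset hf.2, hf.1⟩
  colour w := S.colour (Function.surjInv (toContraction_surjective G e a b) w)
  colour_eq u v h := by
    refine S.colour_eq_of_component_eq ?_
    rw [← Finset.insert_erase hS, ← component_toContraction_iff he _ (Finset.notMem_erase _ _),
      Function.surjInv_eq (toContraction_surjective G e a b),
      Function.surjInv_eq (toContraction_surjective G e a b)]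
    exact Quot.sound h

lemma liftState_contractState (he : G.IsLink e a b) (S : EnhancedState G) (hS : e ∈ S.edges) :
    liftState he (contractState he S hS) = S := by
  refine EnhancedState.ext (Finset.insert_erase hS) (funext fun v => ?_)
  refine S.colour_eq_of_component_eq ?_
  rw [← Finset.insert_erase hS, ← component_toContraction_iff he _ (Finset.notMem_erase _ _),
    Function.surjInv_eq (toContraction_surjective G e a b)]

lemma contractState_liftState (he : G.IsLink e a b) (S : EnhancedState (contraction G e a b)) :
    contractState he (liftState he S) (Finset.mem_insert_self _ _) = S :=
  EnhancedState.ext (Finset.erase_insert (notMem_edges_contraction S))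
    (funext fun w => congrArg S.colour (Function.surjInv_eq _ w))

/-- The retraction of `α` that vanishes on the states without `e`. -/
def contractCochain (he : G.IsLink e a b) : Cochain G →ₗ[ℤ] Cochain (contraction G e a b) :=
  Finsupp.linearCombination ℤ fun S =>
    if hS : e ∈ S.edges then (-1 : ℤ) ^ ((contractState he S hS).edges.filter (e < ·)).card •
      Finsupp.single (contractState he S hS) 1 else 0

lemma contractCochain_single (he : G.IsLink e a b) (S : EnhancedState G) :
    contractCochain he (Finsupp.single S 1) =
      if hS : e ∈ S.edges then (-1 : ℤ) ^ ((contractState he S hS).edges.filter (e < ·)).card •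
        Finsupp.single (contractState he S hS) 1 else 0 := by
  rw [contractCochain, Finsupp.linearCombination_single, one_smul]

lemma hasBidegree_contractCochain (he : G.IsLink e a b) :
    HasBidegree (contractCochain he) (-1, 0) := by
  refine HasBidegree.of_single fun S => ?_
  rw [contractCochain_single]
  split_ifs with hS
  · have hcard := card_edges_liftState he (contractState he S hS)
    have hx := xCount_liftState he (contractState he S hS)
    rw [liftState_contractState] at hcard hx
    refine Submodule.smul_mem _ _ (single_mem_bigradedPart ?_ ?_)
    · rw [hcard, Nat.cast_succ, add_neg_cancel_right]
    · rw [hx, add_zero]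
  · exact Submodule.zero_mem _

lemma contractCochain_comp_alpha (he : G.IsLink e a b) :
    contractCochain he ∘ₗ alpha he = LinearMap.id := by
  refine Finsupp.lhom_ext' fun S => LinearMap.ext_ring ?_
  have hS : e ∈ (liftState he S).edges := Finset.mem_insert_self _ _
  simp only [LinearMap.comp_apply, Finsupp.lsingle_apply, alpha_single, map_smul,
    contractCochain_single, dif_pos hS, contractState_liftState, LinearMap.id_apply,
    smul_smul, ← mul_pow, neg_one_mul, neg_neg, one_pow, one_smul]

lemma beta_comp_alpha (he : G.IsLink e a b) : beta G e ∘ₗ alpha he = 0 := by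
  refine Finsupp.lhom_ext' fun S => LinearMap.ext_ring ?_
  have hS : e ∈ (liftState he S).edges := Finset.mem_insert_self _ _
  simp only [LinearMap.comp_apply, Finsupp.lsingle_apply, alpha_single, map_smul, beta_single,
    dif_pos hS, smul_zero, LinearMap.zero_apply]

lemma alpha_contractCochain_add_extendCochain_beta (he : G.IsLink e a b) :
    alpha he ∘ₗ contractCochain he + extendCochain G e ∘ₗ beta G e = LinearMap.id := by
  refine Finsupp.lhom_ext' fun S => LinearMap.ext_ring ?_
  simp only [LinearMap.comp_apply, LinearMap.add_apply, Finsupp.lsingle_apply,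
    contractCochain_single, beta_single, LinearMap.id_apply]
  split_ifs with hS
  · simp only [map_smul, alpha_single, liftState_contractState, smul_smul, ← mul_pow, neg_one_mul,
      neg_neg, one_pow, one_smul, map_zero, add_zero]
  · rw [map_zero, zero_add, extendCochain_single, extendState_restrictState]

variable [Fintype β]

lemma exists_chain_retraction_alpha (he : G.IsLink e a b)
    {σ : Cochain (deletion G e) →ₗ[ℤ] Cochain G}
    (hσ : σ ∘ₗ differential (deletion G e) = differential G ∘ₗ σ)
    (hβσ : beta G e ∘ₗ σ = LinearMap.id) (hσ₀ : HasBidegree σ 0) :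
    ∃ ρ : Cochain G →ₗ[ℤ] Cochain (contraction G e a b),
      ρ ∘ₗ differential G = differential (contraction G e a b) ∘ₗ ρ ∧
      ρ ∘ₗ alpha he = LinearMap.id ∧ alpha he ∘ₗ ρ + σ ∘ₗ beta G e = LinearMap.id ∧
      HasBidegree ρ (-1, 0) := by
  obtain ⟨ρ, rfl, hρ, hρα, hsum⟩ := exists_chain_retraction (alpha_comp_differential he)
    (beta_comp_differential G e) hσ (contractCochain_comp_alpha he) hβσ (beta_comp_alpha he)
    (alpha_contractCochain_add_extendCochain_beta he)
  exact ⟨_, hρ, hρα, hsum, (hasBidegree_contractCochain he).comp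
    (hasBidegree_id.sub (hσ₀.comp (hasBidegree_beta G e)))⟩

namespace IsSplittingEdge

variable [Finite V(G)] {a b : V(G)}

theorem isSplitExact_alphaStar_betaStar (h : IsSplittingEdge G e a b) (i j : ℤ) :
    IsSplitExact (alphaStar h.isLink i j) (betaStar G e (i + 1) j) := by
  obtain ⟨σ, hσ, hβσ, hσ₀⟩ := h.exists_chain_section_beta
  obtain ⟨ρ, hρ, hρα, hsum, hρ₁⟩ := exists_chain_retraction_alpha h.isLink hσ hβσ hσ₀
  refine isSplitExact_homologyAtMap _ _ hρ hσ _ _ _ _ ?_ ?_ ?_ ?_ hρα hβσ hsum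
  · exact hρ₁.bigradedPart_le_comap (by ring) (add_zero j)
  · exact hρ₁.bigradedPart_le_comap (add_neg_cancel_right i 1) (add_zero j)
  · exact hσ₀.bigradedPart_le_comap (add_zero _) (add_zero j)
  · exact hσ₀.bigradedPart_le_comap (add_zero _) (add_zero j)

theorem isSplitExact_alphaStarTotal_betaStarTotal (h : IsSplittingEdge G e a b) (i : ℤ) :
    IsSplitExact (alphaStarTotal h.isLink i) (betaStarTotal G e (i + 1)) := by
  obtain ⟨σ, hσ, hβσ, hσ₀⟩ := h.exists_chain_section_beta
  obtain ⟨ρ, hρ, hρα, hsum, hρ₁⟩ := exists_chain_retraction_alpha h.isLink hσ hβσ hσ₀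
  refine isSplitExact_homologyAtMap _ _ hρ hσ _ _ _ _ ?_ ?_ ?_ ?_ hρα hβσ hsum
  · exact hρ₁.gradedPart_le_comap (by ring)
  · exact hρ₁.gradedPart_le_comap (add_neg_cancel_right i 1)
  · exact hσ₀.gradedPart_le_comap (add_zero _)
  · exact hσ₀.gradedPart_le_comap (add_zero _)

end IsSplittingEdge

end ShortExact

section GraphK

variable {n m : ℕ}

lemma graphK_adj {u v : Fin n} (huv : u ≠ v) (hu : (u : ℕ) + 1 < n) (hv : (v : ℕ) + 1 < n) :
    (graphK n m).Adj u v := by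
  rcases lt_or_gt_of_ne huv with h | h
  · exact ⟨toLex (u, v), ⟨h, Or.inl hv⟩, Or.inl rfl⟩
  · exact ⟨toLex (v, u), ⟨h, Or.inl hu⟩, Or.inr rfl⟩

lemma eq_toLex_of_graphK_isLink {f : Fin n ×ₗ Fin n} {t b : Fin n} (hb : (b : ℕ) + 1 = n)
    (h : (graphK n m).IsLink f t b) : f = toLex (t, b) ∧ t < b := by
  obtain ⟨⟨hlt, -⟩, hf | hf⟩ := h <;> rw [hf] at hlt
  · exact ⟨hf, hlt⟩
  · have : (b : ℕ) < t := hlt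
    omega

lemma isSplittingEdge_graphK (hn : 4 ≤ n) (hm : 2 ≤ m) (hmn : m < n) {a b : Fin n}
    (ha : (a : ℕ) + 1 = m) (hb : (b : ℕ) + 1 = n) :
    IsSplittingEdge (graphK n m) (toLex (a, b)) ⟨a, Set.mem_univ a⟩ ⟨b, Set.mem_univ b⟩ where
  isLink := graphK_isLink hmn ha hb
  ne h := by
    have : (a : ℕ) = b := congrArg (fun v => (v.1 : ℕ)) h
    omega
  triangle := by
    rintro f ⟨t, _⟩ hf hft
    obtain ⟨rfl, htb⟩ := eq_toLex_of_graphK_isLink hb hft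
    have hta : t ≠ a := fun h => hf (by rw [h])
    have htn : (t : ℕ) + 1 < n := (Nat.succ_lt_succ htb).trans_eq hb
    have han : (a : ℕ) + 1 < n := by omega
    exact ⟨fun h => htb.ne (congrArg Subtype.val h), graphK_adj hta htn han⟩
  exists_path := by
    obtain ⟨p, hp₀, hpn, hpa⟩ : ∃ p : Fin n, (p : ℕ) ≠ 0 ∧ (p : ℕ) + 1 < n ∧ p ≠ a := by
      by_cases h : (a : ℕ) = 1
      · exact ⟨⟨2, by omega⟩, two_ne_zero, by lia, by grind⟩
      · exact ⟨⟨1, by omega⟩, one_ne_zero, by lia, by grind⟩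
    let u : Fin n := ⟨0, by omega⟩
    have hub : (graphK n m).IsLink (toLex (u, b)) u b :=
      ⟨⟨show 0 < (b : ℕ) by omega, Or.inr ⟨hb, show 0 < m by omega⟩⟩, Or.inl rfl⟩
    refine ⟨⟨u, Set.mem_univ u⟩, ⟨p, Set.mem_univ p⟩, _, ?_, hub, ?_,
      graphK_adj (fun h => hp₀ (congrArg Fin.val h.symm)) (by grind) hpn,
      graphK_adj hpa hpn (show (a : ℕ) + 1 < n by omega)⟩
    · intro h
      have : (0 : ℕ) = a := congrArg (fun f => ((ofLex f).1 : ℕ)) h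
      omega
    · intro h
      have : (p : ℕ) = b := congrArg (fun v => (v.1 : ℕ)) h
      omega

end GraphK

end

end ChromaticHomology

theorem mainTheorem1_general {α β : Type*} [LinearOrder β] [Fintype β] {G : Graph α β}
    [Finite V(G)] {e : β} {a b : V(G)} (h : ChromaticHomology.IsSplittingEdge G e a b) :
    (∀ i j : ℤ, ChromaticHomology.IsSplitExact (ChromaticHomology.alphaStar h.isLink i j)
      (ChromaticHomology.betaStar G e (i + 1) j)) ∧
    ∀ i : ℤ, ChromaticHomology.IsSplitExact (ChromaticHomology.alphaStarTotal h.isLink i)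
      (ChromaticHomology.betaStarTotal G e (i + 1)) :=
  ⟨h.isSplitExact_alphaStar_betaStar, h.isSplitExact_alphaStarTotal_betaStarTotal⟩

theorem mainTheorem1 (n m : ℕ) (hn : 4 ≤ n) (hm : 2 ≤ m) (hmn : m < n)
    (a b : Fin n) (ha : (a : ℕ) + 1 = m) (hb : (b : ℕ) + 1 = n) :
    (∀ i j : ℤ, (i + j = n - 2 ∨ i + j = n - 1 ∨ i + j = n) →
      ChromaticHomology.IsSplitExact
        (ChromaticHomology.alphaStar (ChromaticHomology.graphK_isLink hmn ha hb) i j)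
        (ChromaticHomology.betaStar (ChromaticHomology.graphK n m) (toLex (a, b)) (i + 1) j)) ∧
    (∀ i : ℤ,
      ChromaticHomology.IsSplitExact
        (ChromaticHomology.alphaStarTotal (ChromaticHomology.graphK_isLink hmn ha hb) i)
        (ChromaticHomology.betaStarTotal (ChromaticHomology.graphK n m) (toLex (a, b))
          (i + 1))) := by
  have h := mainTheorem1_general (ChromaticHomology.isSplittingEdge_graphK hn hm hmn ha hb)
  exact ⟨fun i j _ => h.1 i j, h.2⟩
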